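/- Let $H$ be a densely defined self-adjoint operator on a complex Hilbert space $\mathscr H$, with projection-valued measure $P^{(H)}$ (so $H=\int\lambda\,dP^{(H)}(\lambda)$) and form domain $\mathcal Q(H)$. Let $a,b\in\mathbb R$, and let $\mathcal E=\mathcal E[a,b]$ be the span of all eigenvectors of $H$ with eigenvalue in $[a,b]$; assume $\dim\mathcal E=m<\infty$, and let $\lambda_1\ge\dots\ge\lambda_m$ be the eigenvalues of $H$ in $\mathcal E$, counted with multiplicity. Let $v_1,\dots,v_m\in\mathcal Q(H)$, let $V:\mathbb C^m\to\mathscr H$, $Vx=\sum_i x_iv_i$, and let $N=P_{\mathcal E^\perp}V$. Let $\delta A,\delta B\in\mathbb C^{m\times m}$ be self-adjoint, and put $$A=V^\dagger HV+\delta A,\qquad B=V^\dagger V+\delta B,\qquad \mathcal N^{(B)}=N^\dagger N+\delta B,$$ where $V^\dagger HV$ is the matrix of the quadratic form of $H$ in the vectors $v_i$. Assume that $B$ is positive definite, and let $\tilde\lambda_1\ge\dots\ge\tilde\lambda_m$ be the eigenvalues of the generalized eigenvalue problem $Ax=\tilde\lambda Bx$, counted with multiplicity. For a self-adjoint $m\times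 m$ matrix $M$ write $\lambda_1(M)\ge\dots\ge\lambda_m(M)$ for its eigenvalues, $\lambda^*_{\min}(M)=\min\{\lambda_m(M),0\}$ and $\lambda^*_{\max}(M)=\max\{\lambda_1(M),0\}$. Assume: (i) the numerical range of $H$ is contained in $[E_{\min},E_{\max}]$, that is, $E_{\min}\|x\|^2\le (x,Hx)\le E_{\max}\|x\|^2$ for all $x$ in the domain of $H$; (ii) the problem is well-conditioned: $\lambda_m(B)>\lambda_1(\mathcal N^{(B)})$; (iii) the continuous part of the spectrum of $H$ has no support in $[a,b]$: if $(x,P^{(H)}(\{t\})x)=0$ for all $t\in\mathbb R$, then $(x,P^{(H)}([a,b])x)=0$. Put $N_<=N^\dagger P^{(H)}((-\infty,a))N$ and $N_>=N^\dagger P^{(H)}((b,\infty))N$, and let $\|\cdot\|$ be the operator norm. Then for every $i\in\{1,\dots,m\}$: if $\tilde\lambda_i\ge E_{\min}$ or $a\le E_{\min}$ (in particular, if $\tilde\lambda_i\ge a$), then $$\frac{(E_{\min}-\tilde\lambda_i)\|N_<\|+\lambda^*_{\min}(\delta A-\tilde\lambda_i\,\delta B)}{\lambda_m(B)-\lambda_1(\mathcal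 N^{(B)})}\le\tilde\lambda_i-\lambda_i;$$ if $\tilde\lambda_i\le E_{\max}$ or $b\ge E_{\max}$ (in particular, if $\tilde\lambda_i\le b$), then $$\tilde\lambda_i-\lambda_i\le\frac{(E_{\max}-\tilde\lambda_i)\|N_>\|+\lambda^*_{\max}(\delta A-\tilde\lambda_i\,\delta B)}{\lambda_m(B)-\lambda_1(\mathcal N^{(B)})}.$$ In particular, both inequalities hold for every $i$ with $\tilde\lambda_i\in[a,b]$ or $\tilde\lambda_i\in[E_{\min},E_{\max}]$. -/

import Mathlib

open MeasureTheory
open scoped InnerProductSpace ComplexOrder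

noncomputable section

/-- A projection-valued measure on the Borel sets of `ℝ`: orthogonal projections, total mass the
identity, countably additive in the strong operator topology. (Only the values on Borel sets
matter.) -/
structure ProjValuedMeasure (E : Type*) [NormedAddCommGroup E] [InnerProductSpace ℂ E]
    [CompleteSpace E] where
  proj : Set ℝ → E →L[ℂ] E
  isStarProjection : ∀ I, MeasurableSet I → IsStarProjection (proj I)
  proj_univ : proj Set.univ = 1
  hasSum_iUnion : ∀ f : ℕ → Set ℝ, (∀ k, MeasurableSet (f k)) →
    Pairwise (Function.onFun Disjoint f) →
    ∀ x, HasSum (fun k => proj (f k) x) (proj (⋃ k, f k) x)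

namespace ProjValuedMeasure

variable {E : Type*} [NormedAddCommGroup E] [InnerProductSpace ℂ E] [CompleteSpace E]

theorem proj_empty (P : ProjValuedMeasure E) : P.proj ∅ = 0 := by
  ext x
  have h := (P.hasSum_iUnion (fun _ => ∅) (fun _ => MeasurableSet.empty)
    (fun _ _ _ => by simp [Function.onFun]) x).summable
  simpa using (summable_const_iff (β := ℕ) _).mp h

theorem re_inner_nonneg (P : ProjValuedMeasure E) {I : Set ℝ} (hI : MeasurableSet I) (x : E) :
    0 ≤ (⟪x, P.proj I x⟫_ℂ).re := by
  have hp := P.isStarProjection I hI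
  have h1 : P.proj I (P.proj I x) = P.proj I x := by
    have := hp.isIdempotentElem
    exact congrArg (fun T : E →L[ℂ] E => T x) this
  have h2 : ⟪x, P.proj I x⟫_ℂ = ⟪P.proj I x, P.proj I x⟫_ℂ := by
    have hs := (ContinuousLinearMap.isSelfAdjoint_iff_isSymmetric.mp hp.isSelfAdjoint)
      x (P.proj I x)
    simp only [ContinuousLinearMap.coe_coe] at hs
    rw [hs, h1]
  rw [h2]
  exact inner_self_nonneg (𝕜 := ℂ)

/-- The scalar spectral measure `I ↦ ⟨x, P(I) x⟩` of a vector `x`. -/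
def scalarMeasure (P : ProjValuedMeasure E) (x : E) : Measure ℝ :=
  Measure.ofMeasurable (fun I _ => ENNReal.ofReal (⟪x, P.proj I x⟫_ℂ).re)
    (by simp [P.proj_empty])
    (by
      intro f hf hd
      have h := P.hasSum_iUnion f hf hd x
      have h2 : HasSum (fun k => (⟪x, P.proj (f k) x⟫_ℂ).re)
          (⟪x, P.proj (⋃ k, f k) x⟫_ℂ).re :=
        Complex.hasSum_re (h.mapL (innerSL ℂ x))
      rw [← h2.tsum_eq]
      exact ENNReal.ofReal_tsum_of_nonneg (fun k => P.re_inner_nonneg (hf k) x) h2.summable)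

open Classical in
/-- The projection-valued measure concentrated at `0` (that of the zero operator); it only serves
to show that projection-valued measures exist. -/
instance : Nonempty (ProjValuedMeasure E) :=
  ⟨{ proj := fun I => if (0 : ℝ) ∈ I then 1 else 0
     isStarProjection := by
       intro I _
       by_cases h : (0 : ℝ) ∈ I
       · simp [h]
       · simp [h]
     proj_univ := by simp
     hasSum_iUnion := by
       intro f _ hd x
       by_cases h : ∃ k, (0 : ℝ) ∈ f k
       · obtain ⟨k, hk⟩ := h
         have hU : (0 : ℝ) ∈ ⋃ k, f k := Set.mem_iUnion.mpr ⟨k, hk⟩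
         have hne : ∀ j, j ≠ k → (0 : ℝ) ∉ f j := fun j hj h0 =>
           Set.disjoint_left.mp (hd hj) h0 hk
         have := hasSum_single (f := fun j =>
           (if (0 : ℝ) ∈ f j then (1 : E →L[ℂ] E) else 0) x) k
           (fun j hj => by simp [hne j hj])
         simpa [hU, hk] using this
       · have hU : (0 : ℝ) ∉ ⋃ k, f k := by simpa using h
         have h' : ∀ k, (0 : ℝ) ∉ f k := by simpa using h
         simp only [h', hU, if_false, zero_apply]
         exact hasSum_zero }⟩

end ProjValuedMeasure

variable {E : Type*} [NormedAddCommGroup E] [InnerProductSpace ℂ E] [CompleteSpace E]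

/-- `H = ∫ t dP(t)`: the domain of `H` consists of the `x` with `∫ t² d⟨x, P(t) x⟩ < ∞`, and
`⟨x, H x⟩ = ∫ t d⟨x, P(t) x⟩` on it (by polarization this determines `H`). -/
def IsSpectralIntegral (H : E →ₗ.[ℂ] E) (P : ProjValuedMeasure E) : Prop :=
  (∀ x, x ∈ H.domain ↔ Integrable (fun t : ℝ => t ^ 2) (P.scalarMeasure x)) ∧
    ∀ x : H.domain, ⟪(x : E), H x⟫_ℂ = ((∫ t, t ∂(P.scalarMeasure (x : E)) : ℝ) : ℂ)

/-- The projection-valued measure `P^(H)` of a self-adjoint operator `H`: the one with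
`H = ∫ t dP(t)`, which exists and is unique (on Borel sets) by the spectral theorem. -/
def spectralPVM (H : E →ₗ.[ℂ] E) : ProjValuedMeasure E :=
  Classical.epsilon (IsSpectralIntegral H)

/-- The form domain `Q(H)`: all `x` with `∫ |t| d⟨x, P^(H)(t) x⟩ < ∞`. -/
def formDomain (H : E →ₗ.[ℂ] E) : Set E :=
  {x | Integrable (fun t : ℝ => t) ((spectralPVM H).scalarMeasure x)}

/-- The quadratic form `(x, H x) = ∫ t d⟨x, P^(H)(t) x⟩` on the form domain. -/
def quadForm (H : E →ₗ.[ℂ] E) (x : E) : ℝ :=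
  ∫ t, t ∂((spectralPVM H).scalarMeasure x)

/-- The sesquilinear form `(x, H y)` on the form domain, obtained from the quadratic form by
polarization (conjugate-linear in `x`). -/
def sesqForm (H : E →ₗ.[ℂ] E) (x y : E) : ℂ :=
  (((quadForm H (x + y) : ℝ) : ℂ) - ((quadForm H (x - y) : ℝ) : ℂ)
    + (((quadForm H (x - Complex.I • y) : ℝ) : ℂ)
      - ((quadForm H (x + Complex.I • y) : ℝ) : ℂ)) * Complex.I) / 4

/-- The band `ℰ[a,b]`: the span of all eigenvectors of `H` with eigenvalue in `[a,b]`. -/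
def bandSubspace (H : E →ₗ.[ℂ] E) (a b : ℝ) : Submodule ℂ E :=
  Submodule.span ℂ {x | ∃ hx : x ∈ H.domain, ∃ t ∈ Set.Icc a b, H ⟨x, hx⟩ = (t : ℂ) • x}

/-- The continuous part of the spectral measure of `H` does not charge `[a,b]`: whenever the scalar
spectral measure of `x` has no atoms (`x` lies in the continuous subspace of `H`), it vanishes
on `[a,b]`. -/
def NoContinuousSpectrumOn (H : E →ₗ.[ℂ] E) (a b : ℝ) : Prop :=
  ∀ x : E, (∀ t : ℝ, (spectralPVM H).scalarMeasure x {t} = 0) →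
    (spectralPVM H).scalarMeasure x (Set.Icc a b) = 0

/-- `lam 0 ≥ ⋯ ≥ lam (m-1)` are the eigenvalues of `H` in the subspace `K`, with multiplicity. -/
def IsEigenvaluesIn (H : E →ₗ.[ℂ] E) (K : Submodule ℂ E) {m : ℕ} (lam : Fin m → ℝ) : Prop :=
  Antitone lam ∧ ∃ e : Fin m → E, Orthonormal ℂ e ∧ Submodule.span ℂ (Set.range e) = K ∧
    ∀ i, ∃ hi : e i ∈ H.domain, H ⟨e i, hi⟩ = (lam i : ℂ) • e i

/-- `lam 0 ≥ ⋯ ≥ lam (m-1)` are the eigenvalues of the generalized eigenvalue problem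
`A b = lam B b`, with multiplicity. -/
def IsGenEigenvalues {m : ℕ} (A B : Matrix (Fin m) (Fin m) ℂ) (lam : Fin m → ℝ) : Prop :=
  Antitone lam ∧ ∃ c : Fin m → Fin m → ℂ, LinearIndependent ℂ c ∧
    ∀ i, A.mulVec (c i) = (lam i : ℂ) • B.mulVec (c i)

/-- The largest eigenvalue `λ₁(M)` of a Hermitian matrix. -/
def eigMax {m : ℕ} (M : Matrix (Fin m) (Fin m) ℂ) : ℝ := sSup (spectrum ℝ M)

/-- The smallest eigenvalue `λ_m(M)` of a Hermitian `m × m` matrix. -/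
def eigMin {m : ℕ} (M : Matrix (Fin m) (Fin m) ℂ) : ℝ := sInf (spectrum ℝ M)

/-- `λ*_max(M) = max {λ₁(M), 0}`. -/
def eigMaxStar {m : ℕ} (M : Matrix (Fin m) (Fin m) ℂ) : ℝ := max (eigMax M) 0

/-- `λ*_min(M) = min {λ_m(M), 0}`. -/
def eigMinStar {m : ℕ} (M : Matrix (Fin m) (Fin m) ℂ) : ℝ := min (eigMin M) 0

/-- The matrix `V† H V` of the form of `H` in the trial vectors (the columns of `V`). -/
def formMatrix (H : E →ₗ.[ℂ] E) {m : ℕ} (v : Fin m → E) : Matrix (Fin m) (Fin m) ℂ :=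
  Matrix.of fun i j => sesqForm H (v i) (v j)

/-- The matrix `N† P^(H)(I) N`, where `N` has the columns `n`. -/
def spectralMatrix (H : E →ₗ.[ℂ] E) {m : ℕ} (n : Fin m → E) (I : Set ℝ) :
    Matrix (Fin m) (Fin m) ℂ :=
  Matrix.of fun i j => ⟪n i, (spectralPVM H).proj I (n j)⟫_ℂ

/-- The columns of the noise map `N = P_{K^⊥} V`, where `V` has the columns `v`. -/
def noise (K : Submodule ℂ E) [K.HasOrthogonalProjection] {m : ℕ} (v : Fin m → E) : Fin m → E :=
  fun i => Kᗮ.starProjection (v i)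

/-- The norm of a matrix as an operator on Euclidean `ℂ^m`. -/
def matrixOpNorm {m : ℕ} (M : Matrix (Fin m) (Fin m) ℂ) : ℝ :=
  ‖Matrix.toEuclideanCLM (n := Fin m) (𝕜 := ℂ) M‖

end

/-!
The bounds on the numerical range make `H` a bounded self-adjoint operator `T`. Riesz–Markov applied
to `f ↦ ⟨x, f(T) x⟩` gives its scalar spectral measures, and these come from a projection-valued
measure: the Borel sets whose projection exists form a λ-system containing the closed sets.

Let `e k` be orthonormal eigenvectors spanning the band, `u = V x`, `y k = ⟨e k, u⟩`, and let `n` be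
the component of `u` orthogonal to the band. For real `s` the form of `A - s B` at `x` equals
`∑ k, (λ k - s) |y k|² + (⟨n, T n⟩ - s ‖n‖²) + ⟨x, (δA - s δB) x⟩`. Since `n` has no spectral mass
in `[a, b]`, for `s ≥ a` the middle term is at most `(Emax - s) ‖P((b, ∞)) n‖²`, hence at most
`(Emax - s) ‖N_>‖ ‖x‖²` if `s ≤ Emax`, while `N_> = 0` if `Emax ≤ b`. Well-conditioning says that
the band component controls `x`: `(λ_min(B) - λ_max(NB)) ‖x‖² ≤ ∑ k, |y k|²`.

Take `s` to be the `i`-th generalized eigenvalue. The span of the first `i` generalized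
eigenvectors, on which the form of `A - s B` is nonnegative, contains by a dimension count some
`x ≠ 0` with `y k = 0` for all `k < i`. For this `x` and `λ i ≤ s` the first sum is at most
`(λ i - s) ∑ k, |y k|²`, and the upper bound follows. The lower bound is the same argument for `-H`
with the order of the indices reversed.
-/

section NumericalRange

variable {E : Type*} [NormedAddCommGroup E] [InnerProductSpace ℂ E]

theorem norm_le_mul_of_re_inner_le {u : E} {M r : ℝ} (hM : 0 < M) (hr : 0 ≤ r)
    (h : ∀ y : E, (⟪y, u⟫_ℂ).re ≤ M / 2 * (r ^ 2 + ‖y‖ ^ 2)) : ‖u‖ ≤ M * r := by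
  have h_scaled := h (((M⁻¹ : ℝ) : ℂ) • u)
  rw [inner_smul_left, norm_smul, inner_self_eq_norm_sq_to_K] at h_scaled
  simp only [Complex.conj_ofReal, Complex.norm_real, Real.norm_eq_abs,
    abs_of_pos (inv_pos.mpr hM), Complex.coe_algebraMap] at h_scaled
  rw [← Complex.ofReal_pow, ← Complex.ofReal_mul, Complex.ofReal_re] at h_scaled
  have h_sq : ‖u‖ ^ 2 ≤ (M * r) ^ 2 := by
    have h_mul := mul_le_mul_of_nonneg_left h_scaled hM.le
    field_simp at h_mul
    linarith
  exact le_of_sq_le_sq h_sq (by positivity)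

theorem re_inner_apply_le_of_abs_re_inner_self_le {H : E →ₗ.[ℂ] E} (hsymm : H.IsFormalAdjoint H)
    {M : ℝ} (hq : ∀ x : H.domain, |(⟪(x : E), H x⟫_ℂ).re| ≤ M * ‖(x : E)‖ ^ 2)
    (x y : H.domain) :
    (⟪(y : E), H x⟫_ℂ).re ≤ M / 2 * (‖(x : E)‖ ^ 2 + ‖(y : E)‖ ^ 2) := by
  have h_add := (abs_le.mp (hq (x + y))).2
  have h_sub := (abs_le.mp (hq (x - y))).1
  have h_comm : (⟪(x : E), H y⟫_ℂ).re = (⟪(y : E), H x⟫_ℂ).re := by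
    rw [← hsymm x y, ← inner_conj_symm, Complex.conj_re]
  have h_parallelogram := parallelogram_law_with_norm ℂ (x : E) (y : E)
  simp only [LinearPMap.map_add, LinearPMap.map_sub, Submodule.coe_add, Submodule.coe_sub,
    inner_add_left, inner_add_right, inner_sub_left, inner_sub_right, Complex.add_re,
    Complex.sub_re] at h_add h_sub
  linear_combination (1 / 4) * h_add + (1 / 4) * h_sub + M / 4 * h_parallelogram - (1 / 2) * h_comm

theorem norm_apply_le_of_abs_re_inner_self_le {H : E →ₗ.[ℂ] E}
    (hdense : Dense (H.domain : Set E)) (hsymm : H.IsFormalAdjoint H) {M : ℝ} (hM : 0 < M)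
    (hq : ∀ x : H.domain, |(⟪(x : E), H x⟫_ℂ).re| ≤ M * ‖(x : E)‖ ^ 2) (x : H.domain) :
    ‖H x‖ ≤ M * ‖(x : E)‖ :=
  norm_le_mul_of_re_inner_le hM (norm_nonneg _) <| hdense.induction
    (fun y hy => re_inner_apply_le_of_abs_re_inner_self_le hsymm hq x ⟨y, hy⟩)
    (isClosed_le (by fun_prop) (by fun_prop))

variable [CompleteSpace E]

theorem domain_eq_top_of_norm_apply_le {H : E →ₗ.[ℂ] E} (hH : IsSelfAdjoint H) {M : ℝ}
    (hb : ∀ x : H.domain, ‖H x‖ ≤ M * ‖(x : E)‖) : H.domain = ⊤ := by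
  rw [Submodule.eq_top_iff']
  intro y
  rw [← LinearPMap.isSelfAdjoint_def.mp hH, LinearPMap.mem_adjoint_domain_iff]
  exact (innerSL ℂ y).continuous.comp (H.toFun.mkContinuous M hb).continuous

theorem exists_continuousLinearMap_of_numericalRange_subset {H : E →ₗ.[ℂ] E}
    (hH : IsSelfAdjoint H) {Emin Emax : ℝ}
    (hE : ∀ x : H.domain, Emin * ‖(x : E)‖ ^ 2 ≤ (⟪(x : E), H x⟫_ℂ).re ∧
      (⟪(x : E), H x⟫_ℂ).re ≤ Emax * ‖(x : E)‖ ^ 2) :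
    ∃ T : E →L[ℂ] E, IsSelfAdjoint T ∧ H.domain = ⊤ ∧
      ∀ (x : E) (hx : x ∈ H.domain), H ⟨x, hx⟩ = T x := by
  have hdense := hH.dense_domain
  have hsymm : H.IsFormalAdjoint H := by
    simpa only [LinearPMap.isSelfAdjoint_def.mp hH] using
      LinearPMap.adjoint_isFormalAdjoint hdense
  have hbound := norm_apply_le_of_abs_re_inner_self_le hdense hsymm
    (M := |Emin| + |Emax| + 1) (by positivity) fun x => by
      obtain ⟨h_lower, h_upper⟩ := hE x
      rw [abs_le]
      constructor
      · nlinarith [neg_abs_le Emin, abs_nonneg Emax, sq_nonneg ‖(x : E)‖]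
      · nlinarith [le_abs_self Emax, abs_nonneg Emin, sq_nonneg ‖(x : E)‖]
  have htop := domain_eq_top_of_norm_apply_le hH hbound
  have hmem : ∀ x, x ∈ H.domain := fun x => htop ▸ Submodule.mem_top
  let L : E →ₗ[ℂ] E := H.toFun ∘ₗ LinearMap.codRestrict H.domain LinearMap.id hmem
  refine ⟨L.mkContinuous _ (fun x => hbound ⟨x, hmem x⟩), ?_, htop, fun x hx => rfl⟩
  rw [ContinuousLinearMap.isSelfAdjoint_iff_isSymmetric]
  exact fun x y => hsymm ⟨x, hmem x⟩ ⟨y, hmem y⟩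

end NumericalRange

section SpectralMeasure

open CompactlySupported

variable {E : Type*} [NormedAddCommGroup E] [InnerProductSpace ℂ E] [CompleteSpace E]
variable {T : E →L[ℂ] E} (hT : IsSelfAdjoint T)

/-- The positive functional `f ↦ ⟨x, f(T) x⟩` on the continuous functions on the spectrum of a
self-adjoint operator `T`, which the Riesz–Markov–Kakutani theorem turns into the spectral measure
of `x`. -/
noncomputable def spectralFunctional (x : E) : C_c(spectrum ℝ T, ℝ) →ₚ[ℝ] ℝ :=
  PositiveLinearMap.mk₀
    { toFun := fun f => (⟪x, cfcHom hT f.toContinuousMap x⟫_ℂ).re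
      map_add' := fun f g => by
        have : (f + g).toContinuousMap = f.toContinuousMap + g.toContinuousMap := rfl
        simp [this]
      map_smul' := fun c f => by
        have : (c • f).toContinuousMap = c • f.toContinuousMap := rfl
        simp [this] }
    fun f hf => by
      have h : 0 ≤ cfcHom hT f.toContinuousMap := (cfcHom_nonneg_iff hT).mpr fun t => hf t
      rw [ContinuousLinearMap.nonneg_iff_isPositive] at h
      exact h.re_inner_nonneg_right x

/-- The spectral measure of the vector `x` with respect to a bounded self-adjoint operator `T`: the
measure that represents `spectralFunctional`, pushed forward from the spectrum to `ℝ`. -/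
noncomputable def spectralMeasure (x : E) : Measure ℝ :=
  (RealRMK.rieszMeasure (spectralFunctional hT x)).map (↑)

instance (x : E) : IsFiniteMeasure (spectralMeasure hT x) :=
  inferInstanceAs (IsFiniteMeasure (Measure.map _ _))

theorem integrable_spectralMeasure (x : E) {f : ℝ → ℝ} (hf : Continuous f) :
    Integrable f (spectralMeasure hT x) := by
  rw [spectralMeasure,
    integrable_map_measure hf.aestronglyMeasurable measurable_subtype_coe.aemeasurable]
  exact (hf.comp continuous_subtype_val).integrable_of_hasCompactSupport
    (HasCompactSupport.of_compactSpace _)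

theorem integral_spectralMeasure (x : E) {f : ℝ → ℝ} (hf : Continuous f) :
    ∫ t, f t ∂spectralMeasure hT x = (⟪x, cfc f T x⟫_ℂ).re := by
  rw [spectralMeasure, integral_map measurable_subtype_coe.aemeasurable hf.aestronglyMeasurable,
    cfc_apply f T hT hf.continuousOn]
  exact RealRMK.integral_rieszMeasure (spectralFunctional hT x)
    ⟨⟨fun t => f t, hf.comp continuous_subtype_val⟩, HasCompactSupport.of_compactSpace _⟩

theorem inner_cfc_apply (x : E) {f : ℝ → ℝ} (hf : Continuous f) :
    ⟪x, cfc f T x⟫_ℂ = ((∫ t, f t ∂spectralMeasure hT x : ℝ) : ℂ) := by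
  have hsymm : ⟪cfc f T x, x⟫_ℂ = ⟪x, cfc f T x⟫_ℂ :=
    (ContinuousLinearMap.isSelfAdjoint_iff_isSymmetric.mp (cfc_predicate f T)) x x
  rw [integral_spectralMeasure hT x hf]
  exact (Complex.conj_eq_iff_re.mp (by rw [inner_conj_symm, hsymm])).symm

theorem norm_sq_cfc_apply (x : E) {f : ℝ → ℝ} (hf : Continuous f) :
    ‖cfc f T x‖ ^ 2 = ∫ t, f t ^ 2 ∂spectralMeasure hT x := by
  have hsymm : ⟪cfc f T x, cfc f T x⟫_ℂ = ⟪x, cfc f T (cfc f T x)⟫_ℂ :=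
    (ContinuousLinearMap.isSelfAdjoint_iff_isSymmetric.mp (cfc_predicate f T)) _ _
  rw [integral_spectralMeasure hT x (f := fun t => f t ^ 2) (hf.pow 2),
    cfc_pow f 2 T hf.continuousOn, pow_two (cfc f T), mul_apply_eq_comp, ← hsymm,
    inner_self_eq_norm_sq_to_K]
  simp [pow_two]

theorem spectralMeasure_real_univ (x : E) : (spectralMeasure hT x).real Set.univ = ‖x‖ ^ 2 := by
  have h := norm_sq_cfc_apply hT x (f := fun _ => 1) continuous_const
  rw [cfc_const_one ℝ T] at h
  simpa using h.symm

end SpectralMeasure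

section BoundedPointwiseLimit

open Filter Topology

variable {E : Type*} [NormedAddCommGroup E] [InnerProductSpace ℂ E] [CompleteSpace E]
  {T : E →L[ℂ] E} {f : ℕ → ℝ → ℝ} {g : ℝ → ℝ} {C : ℝ}

theorem cauchySeq_cfc_apply (hT : IsSelfAdjoint T) (hf : ∀ n, Continuous (f n))
    (hC : ∀ n t, |f n t| ≤ C) (hlim : ∀ t, Tendsto (fun n => f n t) atTop (𝓝 (g t))) (x : E) :
    CauchySeq fun n => cfc (f n) T x := by
  -- `f ↦ f(T) x` is isometric for the `L²` norm of the spectral measure of `x`.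
  have hint : Tendsto (fun p : ℕ × ℕ => ∫ t, (f p.1 t - f p.2 t) ^ 2 ∂spectralMeasure hT x) atTop
      (𝓝 (∫ _, (0 : ℝ) ∂spectralMeasure hT x)) := by
    refine tendsto_integral_filter_of_dominated_convergence (fun _ => (2 * C) ^ 2)
      (.of_forall fun p => (((hf p.1).sub (hf p.2)).pow 2).aestronglyMeasurable)
      (.of_forall fun p => .of_forall fun t => ?_) (integrable_const _)
      (.of_forall fun t => ?_)
    · rw [Real.norm_eq_abs, abs_of_nonneg (sq_nonneg _)]
      have h1 := abs_le.mp (hC p.1 t)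
      have h2 := abs_le.mp (hC p.2 t)
      exact sq_le_sq' (by linarith) (by linarith)
    · rw [← prod_atTop_atTop_eq]
      have h_sub := ((hlim t).comp tendsto_fst).sub
        ((hlim t).comp (tendsto_snd (f := atTop (α := ℕ))))
      simpa using h_sub.pow 2
  have hdist : ∀ p : ℕ × ℕ, dist (cfc (f p.1) T x) (cfc (f p.2) T x) =
      √(∫ t, (f p.1 t - f p.2 t) ^ 2 ∂spectralMeasure hT x) := fun p => by
    rw [← norm_sq_cfc_apply hT x (f := fun t => f p.1 t - f p.2 t) ((hf p.1).sub (hf p.2)),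
      Real.sqrt_sq (norm_nonneg _), dist_eq_norm,
      cfc_sub (f p.1) (f p.2) T (hf p.1).continuousOn (hf p.2).continuousOn,
      sub_apply]
  rw [cauchySeq_iff_tendsto_dist_atTop_0]
  simpa [hdist, Function.comp_def] using (Real.continuous_sqrt.tendsto _).comp hint

theorem exists_inner_apply_eq_integral_of_tendsto (hT : IsSelfAdjoint T)
    (hf : ∀ n, Continuous (f n)) (hC : ∀ n t, |f n t| ≤ C)
    (hlim : ∀ t, Tendsto (fun n => f n t) atTop (𝓝 (g t))) :
    ∃ S : E →L[ℂ] E, ∀ x, ⟪x, S x⟫_ℂ = ((∫ t, g t ∂spectralMeasure hT x : ℝ) : ℂ) ∧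
      ‖S x‖ ^ 2 = ∫ t, g t ^ 2 ∂spectralMeasure hT x := by
  choose s hs using fun x => cauchySeq_tendsto_of_complete (cauchySeq_cfc_apply hT hf hC hlim x)
  let S : E →L[ℂ] E := continuousLinearMapOfTendsto (fun n => cfc (f n) T)
    (f := s) (tendsto_pi_nhds.mpr hs)
  refine ⟨S, fun x => ⟨?_, ?_⟩⟩
  · have hint : Tendsto (fun n => ∫ t, f n t ∂spectralMeasure hT x) atTop
        (𝓝 (∫ t, g t ∂spectralMeasure hT x)) :=
      tendsto_integral_of_dominated_convergence (fun _ => C)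
        (fun n => (hf n).aestronglyMeasurable) (integrable_const _)
        (fun n => .of_forall (hC n)) (.of_forall hlim)
    refine tendsto_nhds_unique (tendsto_const_nhds.inner (hs x)) ?_
    simpa only [inner_cfc_apply hT x (hf _), Function.comp_def] using
      (Complex.continuous_ofReal.tendsto _).comp hint
  · refine tendsto_nhds_unique ((hs x).norm.pow 2) ?_
    simp only [norm_sq_cfc_apply hT x (hf _)]
    refine tendsto_integral_of_dominated_convergence (fun _ => C ^ 2)
      (fun n => ((hf n).pow 2).aestronglyMeasurable) (integrable_const _)
      (fun n => .of_forall fun t => ?_) (.of_forall fun t => (hlim t).pow 2)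
    rw [norm_pow, Real.norm_eq_abs]
    exact pow_le_pow_left₀ (abs_nonneg _) (hC n t) 2

end BoundedPointwiseLimit

section StarProjection

variable {E : Type*} [NormedAddCommGroup E] [InnerProductSpace ℂ E] [CompleteSpace E]

theorem isStarProjection_of_inner_apply_apply {S : E →L[ℂ] E}
    (h : ∀ x, ⟪S x, S x⟫_ℂ = ⟪x, S x⟫_ℂ) : IsStarProjection S := by
  have hstar : star S * S = S := by
    rw [ContinuousLinearMap.star_eq_adjoint]
    apply ContinuousLinearMap.coe_injective
    rw [← ext_inner_map]
    intro x
    have h_conj := congrArg (starRingEnd ℂ) (h x)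
    rw [inner_conj_symm, inner_conj_symm] at h_conj
    simpa [ContinuousLinearMap.adjoint_inner_left] using h_conj
  have hself : IsSelfAdjoint S := hstar ▸ IsSelfAdjoint.star_mul_self S
  exact ⟨by rw [IsIdempotentElem]; nth_rw 1 [← hself.star_eq]; exact hstar, hself⟩

variable {S : E →L[ℂ] E}

theorem apply_apply_of_isStarProjection (hS : IsStarProjection S) (x : E) : S (S x) = S x :=
  congrArg (fun T : E →L[ℂ] E => T x) hS.isIdempotentElem

theorem inner_apply_left_of_isStarProjection (hS : IsStarProjection S) (x y : E) :
    ⟪S x, y⟫_ℂ = ⟪x, S y⟫_ℂ :=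
  (ContinuousLinearMap.isSelfAdjoint_iff_isSymmetric.mp hS.isSelfAdjoint) x y

theorem inner_apply_self_of_isStarProjection (hS : IsStarProjection S) (x : E) :
    ⟪x, S x⟫_ℂ = ((‖S x‖ ^ 2 : ℝ) : ℂ) := by
  rw [← apply_apply_of_isStarProjection hS x, ← inner_apply_left_of_isStarProjection hS,
    inner_self_eq_norm_sq_to_K, apply_apply_of_isStarProjection hS]
  simp

theorem norm_sq_one_sub_apply_of_isStarProjection (hS : IsStarProjection S) (x : E) :
    ‖(1 - S) x‖ ^ 2 = ‖x‖ ^ 2 - ‖S x‖ ^ 2 := by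
  have h : ⟪x, (1 - S) x⟫_ℂ = ⟪x, (1 : E →L[ℂ] E) x⟫_ℂ - ⟪x, S x⟫_ℂ := by simp
  rw [inner_apply_self_of_isStarProjection hS.one_sub, inner_apply_self_of_isStarProjection hS,
    inner_apply_self_of_isStarProjection (.one _), one_apply_eq_self] at h
  exact_mod_cast h

theorem exists_isStarProjection_hasSum {S : ℕ → E →L[ℂ] E} (hS : ∀ k, IsStarProjection (S k))
    (horth : ∀ i j, i ≠ j → ∀ x, S i (S j x) = 0) (hsum : ∀ x, Summable fun k => ‖S k x‖ ^ 2) :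
    ∃ S' : E →L[ℂ] E, IsStarProjection S' ∧ ∀ x, HasSum (fun k => S k x) (S' x) := by
  have hfamily : OrthogonalFamily ℂ (fun k => (S k).range) fun k => (S k).range.subtypeₗᵢ := by
    rintro i j hij ⟨_, x, rfl⟩ ⟨_, y, rfl⟩
    change ⟪S i x, S j y⟫_ℂ = 0
    rw [inner_apply_left_of_isStarProjection (hS i), horth i j hij, inner_zero_right]
  have hsummable : ∀ x, Summable fun k => S k x := fun x =>
    (hfamily.summable_iff_norm_sq_summable fun k => ⟨S k x, x, rfl⟩).mpr (hsum x)
  have htendsto : Filter.Tendsto (fun n x => (∑ k ∈ Finset.range n, S k) x) Filter.atTop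
      (nhds fun x => ∑' k, S k x) := by
    rw [tendsto_pi_nhds]
    intro x
    simpa using (hsummable x).hasSum.tendsto_sum_nat
  let S' : E →L[ℂ] E := continuousLinearMapOfTendsto (fun n => ∑ k ∈ Finset.range n, S k) htendsto
  have hS' : ∀ x, HasSum (fun k => S k x) (S' x) := fun x => (hsummable x).hasSum
  have hSS' : ∀ k x, S k (S' x) = S k x := fun k x => by
    have h_single := hasSum_single (f := fun j => S k (S j x)) k fun j hj => horth k j hj.symm x
    exact (((hS' x).mapL (S k)).unique h_single).trans (apply_apply_of_isStarProjection (hS k) x)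
  refine ⟨S', isStarProjection_of_inner_apply_apply fun x => ?_, hS'⟩
  have hterm : ∀ k, ⟪S' x, S k x⟫_ℂ = ⟪x, S k x⟫_ℂ := fun k => by
    rw [← inner_apply_left_of_isStarProjection (hS k), hSS',
      inner_apply_left_of_isStarProjection (hS k)]
  refine ((hS' x).mapL (innerSL ℂ (S' x))).unique ?_
  simpa only [innerSL_apply_apply, hterm] using (hS' x).mapL (innerSL ℂ x)

end StarProjection

/-- `S` is the orthogonal projection that a projection-valued measure with scalar measures `μ x`
must assign to the set `I`. -/
structure IsSpectralProjection {α E : Type*} [MeasurableSpace α] [NormedAddCommGroup E]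
    [InnerProductSpace ℂ E] [CompleteSpace E] (μ : E → Measure α) (I : Set α) (S : E →L[ℂ] E) :
    Prop where
  isStarProjection : IsStarProjection S
  norm_sq_apply : ∀ x, ‖S x‖ ^ 2 = (μ x).real I

namespace IsSpectralProjection

variable {α E : Type*} [MeasurableSpace α] [NormedAddCommGroup E] [InnerProductSpace ℂ E]
  [CompleteSpace E]
variable {μ : E → Measure α} {I J : Set α} {S S' : E →L[ℂ] E}

theorem inner_apply (h : IsSpectralProjection μ I S) (x : E) :
    ⟪x, S x⟫_ℂ = (((μ x).real I : ℝ) : ℂ) := by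
  rw [inner_apply_self_of_isStarProjection h.isStarProjection, h.norm_sq_apply]

theorem unique (h : IsSpectralProjection μ I S) (h' : IsSpectralProjection μ I S') : S = S' := by
  apply ContinuousLinearMap.coe_injective
  rw [← ext_inner_map]
  intro x
  rw [ContinuousLinearMap.coe_coe, ContinuousLinearMap.coe_coe, ← inner_conj_symm,
    ← inner_conj_symm (S' x), h.inner_apply, h'.inner_apply]

theorem univ (hμ : ∀ x, (μ x).real Set.univ = ‖x‖ ^ 2) :
    IsSpectralProjection μ Set.univ (1 : E →L[ℂ] E) :=
  ⟨IsStarProjection.one _, fun x => by simp [hμ]⟩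

variable [∀ x, IsFiniteMeasure (μ x)]

theorem compl (hμ : ∀ x, (μ x).real Set.univ = ‖x‖ ^ 2) (hI : MeasurableSet I)
    (h : IsSpectralProjection μ I S) : IsSpectralProjection μ Iᶜ (1 - S) :=
  ⟨h.isStarProjection.one_sub, fun x => by
    rw [norm_sq_one_sub_apply_of_isStarProjection h.isStarProjection, measureReal_compl hI, hμ,
      h.norm_sq_apply]⟩

theorem apply_apply_eq_zero (hμ : ∀ x, (μ x).real Set.univ = ‖x‖ ^ 2) (hJ : MeasurableSet J)
    (h : IsSpectralProjection μ I S) (h' : IsSpectralProjection μ J S') (hd : Disjoint I J)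
    (x : E) : S' (S x) = 0 := by
  have h_le : (μ (S x)).real I + (μ (S x)).real J ≤ ‖S x‖ ^ 2 := by
    rw [← hμ, ← measureReal_union hd hJ]
    exact measureReal_mono (Set.subset_univ _)
  rw [← h.norm_sq_apply, ← h'.norm_sq_apply,
    apply_apply_of_isStarProjection h.isStarProjection] at h_le
  have h_sq : ‖S' (S x)‖ ^ 2 = 0 := le_antisymm (by linarith) (sq_nonneg _)
  simpa using h_sq

theorem exists_iUnion (hμ : ∀ x, (μ x).real Set.univ = ‖x‖ ^ 2) {f : ℕ → Set α}
    (hf : ∀ k, MeasurableSet (f k)) (hd : Pairwise (Function.onFun Disjoint f))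
    {S : ℕ → E →L[ℂ] E} (h : ∀ k, IsSpectralProjection μ (f k) (S k)) :
    ∃ S' : E →L[ℂ] E, IsSpectralProjection μ (⋃ k, f k) S' ∧
      ∀ x, HasSum (fun k => S k x) (S' x) := by
  have hnorm : ∀ x, HasSum (fun k => (μ x).real (f k)) ((μ x).real (⋃ k, f k)) := fun x => by
    have h_sum := ENNReal.hasSum_toReal (f := fun k => μ x (f k))
      (by rw [← measure_iUnion hd hf]; exact measure_ne_top _ _)
    rwa [← ENNReal.tsum_toReal_eq (fun k => measure_ne_top _ _), ← measure_iUnion hd hf] at h_sum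
  obtain ⟨S', hS', hsum⟩ := exists_isStarProjection_hasSum (fun k => (h k).isStarProjection)
    (fun i j hij => (h j).apply_apply_eq_zero hμ (hf i) (h i) (hd hij.symm))
    (fun x => by simpa only [(h _).norm_sq_apply] using (hnorm x).summable)
  refine ⟨S', ⟨hS', fun x => ?_⟩, hsum⟩
  have h_inner : HasSum (fun k => (((μ x).real (f k) : ℝ) : ℂ)) ⟪x, S' x⟫_ℂ := by
    simpa only [innerSL_apply_apply, (h _).inner_apply] using (hsum x).mapL (innerSL ℂ x)
  have h_eq := h_inner.unique (Complex.hasSum_ofReal.mpr (hnorm x))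
  rw [inner_apply_self_of_isStarProjection hS'] at h_eq
  exact_mod_cast h_eq

end IsSpectralProjection

section SpectralTheorem

variable {E : Type*} [NormedAddCommGroup E] [InnerProductSpace ℂ E] [CompleteSpace E]
variable {T : E →L[ℂ] E} (hT : IsSelfAdjoint T)

theorem exists_isSpectralProjection_of_isClosed {F : Set ℝ} (hF : IsClosed F) :
    ∃ S, IsSpectralProjection (spectralMeasure hT) F S := by
  have hδ : ∀ n : ℕ, 0 < 1 / ((n : ℝ) + 1) := fun n => Nat.one_div_pos_of_nat
  have hlim : ∀ t, Filter.Tendsto (fun n => (thickenedIndicator (hδ n) F t : ℝ)) Filter.atTop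
      (nhds (F.indicator 1 t)) := fun t => by
    have h := thickenedIndicator_tendsto_indicator_closure hδ
      tendsto_one_div_add_atTop_nhds_zero_nat F
    rw [tendsto_pi_nhds, hF.closure_eq] at h
    have hcoe : F.indicator (1 : ℝ → ℝ) t = ((F.indicator 1 t : NNReal) : ℝ) := by
      by_cases ht : t ∈ F <;> simp [ht]
    rw [hcoe]
    exact (NNReal.continuous_coe.tendsto _).comp (h t)
  obtain ⟨S, hS⟩ := exists_inner_apply_eq_integral_of_tendsto hT (C := 1)
    (fun n => NNReal.continuous_coe.comp (thickenedIndicator (hδ n) F).continuous)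
    (fun n t => (NNReal.abs_eq _).trans_le
      (NNReal.coe_le_one.mpr (thickenedIndicator_le_one (hδ n) F t))) hlim
  have hsq : ∀ t, F.indicator (1 : ℝ → ℝ) t ^ 2 = F.indicator 1 t := fun t => by
    by_cases ht : t ∈ F <;> simp [ht]
  simp only [hsq, integral_indicator_one hF.measurableSet] at hS
  refine ⟨S, isStarProjection_of_inner_apply_apply fun x => ?_, fun x => (hS x).2⟩
  rw [(hS x).1, ← (hS x).2, inner_self_eq_norm_sq_to_K]
  simp

theorem exists_isSpectralProjection {I : Set ℝ} (hI : MeasurableSet I) :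
    ∃ S, IsSpectralProjection (spectralMeasure hT) I S := by
  have hborel := (BorelSpace.measurable_eq (α := ℝ)).trans borel_eq_generateFrom_isClosed
  have huniv := spectralMeasure_real_univ hT
  induction I, hI using MeasurableSpace.induction_on_inter hborel isPiSystem_isClosed with
  | empty => exact exists_isSpectralProjection_of_isClosed hT isClosed_empty
  | basic F hF => exact exists_isSpectralProjection_of_isClosed hT hF
  | compl I hI ih => exact ih.elim fun S hS => ⟨1 - S, hS.compl huniv hI⟩
  | iUnion f hd hf ih =>
    choose S hS using ih
    obtain ⟨S', hS', -⟩ := IsSpectralProjection.exists_iUnion huniv hf hd hS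
    exact ⟨S', hS'⟩

theorem exists_projValuedMeasure_scalarMeasure_eq :
    ∃ P : ProjValuedMeasure E, ∀ x, P.scalarMeasure x = spectralMeasure hT x := by
  classical
  have huniv := spectralMeasure_real_univ hT
  have hex : ∀ I : Set ℝ, ∃ S : E →L[ℂ] E,
      MeasurableSet I → IsSpectralProjection (spectralMeasure hT) I S := fun I => by
    by_cases hI : MeasurableSet I
    · exact (exists_isSpectralProjection hT hI).imp fun S hS _ => hS
    · exact ⟨0, fun h => absurd h hI⟩
  choose S hS using hex
  let P : ProjValuedMeasure E :=
    { proj := S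
      isStarProjection := fun I hI => (hS I hI).isStarProjection
      proj_univ := (hS _ MeasurableSet.univ).unique (IsSpectralProjection.univ huniv)
      hasSum_iUnion := fun f hf hd x => by
        obtain ⟨S', h_union, hsum⟩ :=
          IsSpectralProjection.exists_iUnion huniv hf hd fun k => hS (f k) (hf k)
        rw [(hS _ (MeasurableSet.iUnion hf)).unique h_union]
        exact hsum x }
  refine ⟨P, fun x => ?_⟩
  ext I hI
  rw [ProjValuedMeasure.scalarMeasure, Measure.ofMeasurable_apply _ hI]
  change ENNReal.ofReal (⟪x, S I x⟫_ℂ).re = _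
  rw [(hS I hI).inner_apply, Complex.ofReal_re, ofReal_measureReal]

end SpectralTheorem

namespace ProjValuedMeasure

variable {E : Type*} [NormedAddCommGroup E] [InnerProductSpace ℂ E] [CompleteSpace E]
variable (P : ProjValuedMeasure E)

theorem scalarMeasure_apply {I : Set ℝ} (hI : MeasurableSet I) (x : E) :
    P.scalarMeasure x I = ENNReal.ofReal (‖P.proj I x‖ ^ 2) := by
  rw [scalarMeasure, Measure.ofMeasurable_apply _ hI,
    inner_apply_self_of_isStarProjection (P.isStarProjection I hI), Complex.ofReal_re]

instance (x : E) : IsFiniteMeasure (P.scalarMeasure x) :=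
  ⟨by rw [P.scalarMeasure_apply MeasurableSet.univ]; exact ENNReal.ofReal_lt_top⟩

theorem scalarMeasure_real {I : Set ℝ} (hI : MeasurableSet I) (x : E) :
    (P.scalarMeasure x).real I = ‖P.proj I x‖ ^ 2 := by
  rw [measureReal_def, P.scalarMeasure_apply hI, ENNReal.toReal_ofReal (sq_nonneg _)]

theorem isSpectralProjection {I : Set ℝ} (hI : MeasurableSet I) :
    IsSpectralProjection P.scalarMeasure I (P.proj I) :=
  ⟨P.isStarProjection I hI, fun x => (P.scalarMeasure_real hI x).symm⟩

theorem scalarMeasure_real_univ (x : E) : (P.scalarMeasure x).real Set.univ = ‖x‖ ^ 2 := by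
  rw [P.scalarMeasure_real MeasurableSet.univ, P.proj_univ, one_apply_eq_self]

theorem inner_proj_left {I : Set ℝ} (hI : MeasurableSet I) (x y : E) :
    ⟪P.proj I x, y⟫_ℂ = ⟪x, P.proj I y⟫_ℂ :=
  inner_apply_left_of_isStarProjection (P.isStarProjection I hI) x y

theorem proj_proj_self {I : Set ℝ} (hI : MeasurableSet I) (x : E) :
    P.proj I (P.proj I x) = P.proj I x :=
  apply_apply_of_isStarProjection (P.isStarProjection I hI) x

theorem proj_proj_of_disjoint {I J : Set ℝ} (hI : MeasurableSet I) (hJ : MeasurableSet J)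
    (hd : Disjoint I J) (x : E) : P.proj J (P.proj I x) = 0 :=
  (P.isSpectralProjection hI).apply_apply_eq_zero P.scalarMeasure_real_univ hJ
    (P.isSpectralProjection hJ) hd x

theorem proj_union {I J : Set ℝ} (hI : MeasurableSet I) (hJ : MeasurableSet J)
    (hd : Disjoint I J) : P.proj (I ∪ J) = P.proj I + P.proj J := by
  apply ContinuousLinearMap.coe_injective
  rw [← ext_inner_map]
  intro x
  simp only [ContinuousLinearMap.coe_coe, add_apply, inner_add_left]
  rw [P.inner_proj_left hI, P.inner_proj_left hJ, P.inner_proj_left (hI.union hJ),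
    (P.isSpectralProjection hI).inner_apply, (P.isSpectralProjection hJ).inner_apply,
    (P.isSpectralProjection (hI.union hJ)).inner_apply, measureReal_union hd hJ,
    Complex.ofReal_add]

theorem proj_proj {I J : Set ℝ} (hI : MeasurableSet I) (hJ : MeasurableSet J) (x : E) :
    P.proj I (P.proj J x) = P.proj (I ∩ J) x := by
  have hIJ := hI.inter hJ
  have hsplitJ : P.proj J = P.proj (I ∩ J) + P.proj (J \ I) := by
    rw [← P.proj_union hIJ (hJ.diff hI)
      (Set.disjoint_of_subset_left Set.inter_subset_left Set.disjoint_sdiff_right),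
      Set.inter_comm, Set.inter_union_sdiff]
  have hsplitI : P.proj I = P.proj (I ∩ J) + P.proj (I \ J) := by
    rw [← P.proj_union hIJ (hI.diff hJ)
      (Set.disjoint_of_subset_left Set.inter_subset_right Set.disjoint_sdiff_right),
      Set.inter_union_sdiff]
  have hsub : P.proj I (P.proj (I ∩ J) x) = P.proj (I ∩ J) x := by
    rw [hsplitI, add_apply, P.proj_proj_self hIJ, P.proj_proj_of_disjoint hIJ (hI.diff hJ)
      (Set.disjoint_of_subset_left Set.inter_subset_right Set.disjoint_sdiff_right), add_zero]
  rw [hsplitJ, add_apply, map_add, hsub,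
    P.proj_proj_of_disjoint (hJ.diff hI) hI Set.disjoint_sdiff_left, add_zero]

theorem proj_comm {I J : Set ℝ} (hI : MeasurableSet I) (hJ : MeasurableSet J) (x : E) :
    P.proj I (P.proj J x) = P.proj J (P.proj I x) := by
  rw [P.proj_proj hI hJ, P.proj_proj hJ hI, Set.inter_comm]

theorem scalarMeasure_proj {I : Set ℝ} (hI : MeasurableSet I) (x : E) :
    P.scalarMeasure (P.proj I x) = (P.scalarMeasure x).restrict I := by
  ext J hJ
  rw [Measure.restrict_apply hJ, P.scalarMeasure_apply hJ, P.scalarMeasure_apply (hJ.inter hI),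
    P.proj_proj hJ hI]

theorem scalarMeasure_add {I : Set ℝ} (hI : MeasurableSet I) {x y : E} (hx : P.proj I x = x)
    (hy : P.proj I y = 0) :
    P.scalarMeasure (x + y) = P.scalarMeasure x + P.scalarMeasure y := by
  ext J hJ
  rw [Measure.add_apply, P.scalarMeasure_apply hJ, P.scalarMeasure_apply hJ,
    P.scalarMeasure_apply hJ, ← ENNReal.ofReal_add (sq_nonneg _) (sq_nonneg _), map_add]
  have horth : ⟪P.proj J x, P.proj J y⟫_ℂ = 0 := by
    rw [← hx, P.proj_comm hJ hI, P.inner_proj_left hI, P.proj_comm hI hJ, hy, map_zero,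
      inner_zero_right]
  rw [pow_two, norm_add_sq_eq_norm_sq_add_norm_sq_of_inner_eq_zero _ _ horth, pow_two, pow_two]

/-- `P` represents the bounded operator `T` as `T = ∫ t dP(t)`, in the weak sense of quadratic
forms. -/
structure Represents (P : ProjValuedMeasure E) (T : E →L[ℂ] E) : Prop where
  integrable : ∀ x, Integrable (fun t : ℝ => t) (P.scalarMeasure x)
  inner_apply : ∀ x, ⟪x, T x⟫_ℂ = ((∫ t, t ∂P.scalarMeasure x : ℝ) : ℂ)

end ProjValuedMeasure

theorem exists_projValuedMeasure_represents {E : Type*} [NormedAddCommGroup E]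
    [InnerProductSpace ℂ E] [CompleteSpace E] {T : E →L[ℂ] E} (hT : IsSelfAdjoint T) :
    ∃ P : ProjValuedMeasure E, P.Represents T ∧
      ∀ x, Integrable (fun t : ℝ => t ^ 2) (P.scalarMeasure x) := by
  obtain ⟨P, hP⟩ := exists_projValuedMeasure_scalarMeasure_eq hT
  refine ⟨P, ⟨fun x => ?_, fun x => ?_⟩, fun x => ?_⟩
  · rw [hP]; exact integrable_spectralMeasure hT x continuous_id
  · simpa only [hP, cfc_id ℝ T, id_eq] using inner_cfc_apply hT x continuous_id
  · rw [hP]; exact integrable_spectralMeasure hT x (by fun_prop)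

section MeasureLemmas

variable {α : Type*} [MeasurableSpace α] {μ : Measure α} [IsFiniteMeasure μ] {f : α → ℝ}
  {S : Set α} {M s : ℝ}

theorem measure_eq_zero_of_setIntegral_le (hf : IntegrableOn f S μ) (hM : ∀ t ∈ S, M < f t)
    (hint : ∫ t in S, f t ∂μ ≤ M * μ.real S) : μ S = 0 := by
  by_contra hμ
  obtain ⟨t, ht, hle⟩ := exists_le_setAverage hμ (measure_ne_top μ S) hf
  have hpos : 0 < μ.real S := ENNReal.toReal_pos hμ (measure_ne_top μ S)
  have havg : ⨍ u in S, f u ∂μ ≤ M := by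
    rw [setAverage_eq, smul_eq_mul, inv_mul_le_iff₀ hpos, mul_comm]
    exact hint
  exact (hM t ht).not_ge (hle.trans havg)

theorem integral_sub_mul_real_univ_le (hf : Integrable f μ) (hS : MeasurableSet S)
    (h_mem : ∀ᵐ t ∂μ, t ∈ S → f t ≤ M) (h_notMem : ∀ᵐ t ∂μ, t ∉ S → f t ≤ s) :
    ∫ t, f t ∂μ - s * μ.real Set.univ ≤ (M - s) * μ.real S := by
  calc ∫ t, f t ∂μ - s * μ.real Set.univ = ∫ t, (f t - s) ∂μ := by
        rw [integral_sub hf (integrable_const s), integral_const, smul_eq_mul, mul_comm s]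
    _ ≤ ∫ t, S.indicator (fun _ => M - s) t ∂μ := by
        refine integral_mono_ae (hf.sub (integrable_const s))
          ((integrable_const _).indicator hS) ?_
        filter_upwards [h_mem, h_notMem] with t h_in h_out
        by_cases ht : t ∈ S
        · rw [Set.indicator_of_mem ht]; linarith [h_in ht]
        · rw [Set.indicator_of_notMem ht]; linarith [h_out ht]
    _ = (M - s) * μ.real S := by
        rw [integral_indicator_const _ hS, smul_eq_mul, mul_comm]

end MeasureLemmas

namespace ProjValuedMeasure.Represents

variable {E : Type*} [NormedAddCommGroup E] [InnerProductSpace ℂ E] [CompleteSpace E]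
  {P : ProjValuedMeasure E} {T : E →L[ℂ] E}

theorem re_inner_apply (hP : P.Represents T) (x : E) :
    (⟪x, T x⟫_ℂ).re = ∫ t, t ∂P.scalarMeasure x := by
  rw [hP.inner_apply, Complex.ofReal_re]

theorem inner_apply_left (hP : P.Represents T) (x y : E) : ⟪T x, y⟫_ℂ = ⟪x, T y⟫_ℂ :=
  T.toLinearMap.isSymmetric_iff_inner_map_self_real.mpr (fun z => by
    rw [ContinuousLinearMap.coe_coe, inner_conj_symm, ← inner_conj_symm (T z), hP.inner_apply,
      Complex.conj_ofReal]) x y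

theorem inner_apply_eq_zero (hP : P.Represents T) {I : Set ℝ} (hI : MeasurableSet I) {x y : E}
    (hx : P.proj I x = x) (hy : P.proj I y = 0) : ⟪x, T y⟫_ℂ = 0 := by
  have hre : ∀ z, P.proj I z = 0 → (⟪x, T z⟫_ℂ).re = 0 := fun z hz => by
    have h_add := hP.re_inner_apply (x + z)
    rw [P.scalarMeasure_add hI hx hz, integral_add_measure (hP.integrable x) (hP.integrable z),
      ← hP.re_inner_apply, ← hP.re_inner_apply, map_add, inner_add_left, inner_add_right,
      inner_add_right, ← hP.inner_apply_left z, ← inner_conj_symm (T z)] at h_add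
    simp only [Complex.add_re, Complex.conj_re] at h_add
    linarith
  refine Complex.ext (hre y hy) ?_
  have him := hre (Complex.I • y) (by rw [map_smul, hy, smul_zero])
  rw [map_smul, inner_smul_right] at him
  simpa using him

theorem apply_proj_singleton (hP : P.Represents T) (t : ℝ) (x : E) :
    T (P.proj {t} x) = (t : ℂ) • P.proj {t} x := by
  have ht : MeasurableSet ({t} : Set ℝ) := measurableSet_singleton t
  suffices h : ((T * P.proj {t} : E →L[ℂ] E) : E →ₗ[ℂ] E) =
      (((t : ℂ) • P.proj {t} : E →L[ℂ] E) : E →ₗ[ℂ] E) from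
    congrArg (fun L : E →ₗ[ℂ] E => L x) h
  rw [← ext_inner_map]
  intro z
  change ⟪T (P.proj {t} z), z⟫_ℂ = ⟪(t : ℂ) • P.proj {t} z, z⟫_ℂ
  have hoff : ⟪P.proj {t} z, T (z - P.proj {t} z)⟫_ℂ = 0 :=
    hP.inner_apply_eq_zero ht (P.proj_proj_self ht z) (by
      rw [map_sub, P.proj_proj_self ht, sub_self])
  rw [map_sub, inner_sub_right, sub_eq_zero] at hoff
  rw [hP.inner_apply_left, hoff, hP.inner_apply, P.scalarMeasure_proj ht, integral_singleton,
    inner_smul_left, P.inner_proj_left ht, (P.isSpectralProjection ht).inner_apply,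
    Complex.conj_ofReal, smul_eq_mul, Complex.ofReal_mul, mul_comm]

theorem setIntegral_eq (hP : P.Represents T) {I : Set ℝ} (hI : MeasurableSet I) (x : E) :
    ∫ t in I, t ∂P.scalarMeasure x = (⟪P.proj I x, T (P.proj I x)⟫_ℂ).re := by
  rw [hP.re_inner_apply, P.scalarMeasure_proj hI]

section Bounds

variable {M : ℝ}

theorem scalarMeasure_Ioi_eq_zero (hP : P.Represents T)
    (hM : ∀ x, (⟪x, T x⟫_ℂ).re ≤ M * ‖x‖ ^ 2) (x : E) : P.scalarMeasure x (Set.Ioi M) = 0 :=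
  measure_eq_zero_of_setIntegral_le (hP.integrable x).integrableOn (fun _ ht => ht) <| by
    rw [hP.setIntegral_eq measurableSet_Ioi, P.scalarMeasure_real measurableSet_Ioi]
    exact hM _

theorem scalarMeasure_Iio_eq_zero (hP : P.Represents T)
    (hM : ∀ x, M * ‖x‖ ^ 2 ≤ (⟪x, T x⟫_ℂ).re) (x : E) : P.scalarMeasure x (Set.Iio M) = 0 :=
  measure_eq_zero_of_setIntegral_le (f := fun t => -t) (M := -M) (hP.integrable x).integrableOn.neg
    (fun _ ht => neg_lt_neg ht) <| by
    rw [integral_neg, hP.setIntegral_eq measurableSet_Iio, P.scalarMeasure_real measurableSet_Iio,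
      neg_mul]
    exact neg_le_neg (hM _)

theorem proj_Ioi_eq_zero (hP : P.Represents T) (hM : ∀ x, (⟪x, T x⟫_ℂ).re ≤ M * ‖x‖ ^ 2)
    {b : ℝ} (hb : M ≤ b) : P.proj (Set.Ioi b) = 0 := by
  ext x
  have h := measure_mono_null (Set.Ioi_subset_Ioi hb) (hP.scalarMeasure_Ioi_eq_zero hM x)
  simpa [P.scalarMeasure_apply measurableSet_Ioi] using h

theorem proj_Iio_eq_zero (hP : P.Represents T) (hM : ∀ x, M * ‖x‖ ^ 2 ≤ (⟪x, T x⟫_ℂ).re)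
    {a : ℝ} (ha : a ≤ M) : P.proj (Set.Iio a) = 0 := by
  ext x
  have h := measure_mono_null (Set.Iio_subset_Iio ha) (hP.scalarMeasure_Iio_eq_zero hM x)
  simpa [P.scalarMeasure_apply measurableSet_Iio] using h

theorem re_inner_apply_sub_le (hP : P.Represents T) (hM : ∀ x, (⟪x, T x⟫_ℂ).re ≤ M * ‖x‖ ^ 2)
    {a b s : ℝ} (hs : a ≤ s) {x : E} (hx : P.scalarMeasure x (Set.Icc a b) = 0) :
    (⟪x, T x⟫_ℂ).re - s * ‖x‖ ^ 2 ≤ (M - s) * ‖P.proj (Set.Ioi b) x‖ ^ 2 := by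
  rw [hP.re_inner_apply, ← P.scalarMeasure_real_univ x, ← P.scalarMeasure_real measurableSet_Ioi]
  refine integral_sub_mul_real_univ_le (hP.integrable x) measurableSet_Ioi ?_ ?_
  · filter_upwards [measure_eq_zero_iff_ae_notMem.mp (hP.scalarMeasure_Ioi_eq_zero hM x)]
      with t ht _ using not_lt.mp ht
  · filter_upwards [measure_eq_zero_iff_ae_notMem.mp hx] with t ht htb
    exact not_lt.mp fun hst => ht ⟨hs.trans hst.le, not_lt.mp htb⟩

theorem le_re_inner_apply_sub (hP : P.Represents T) (hM : ∀ x, M * ‖x‖ ^ 2 ≤ (⟪x, T x⟫_ℂ).re)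
    {a b s : ℝ} (hs : s ≤ b) {x : E} (hx : P.scalarMeasure x (Set.Icc a b) = 0) :
    (M - s) * ‖P.proj (Set.Iio a) x‖ ^ 2 ≤ (⟪x, T x⟫_ℂ).re - s * ‖x‖ ^ 2 := by
  rw [hP.re_inner_apply, ← P.scalarMeasure_real_univ x, ← P.scalarMeasure_real measurableSet_Iio]
  have h := integral_sub_mul_real_univ_le (f := fun t => -t) (M := -M) (s := -s)
    (hP.integrable x).neg (measurableSet_Iio (a := a)) ?_ ?_
  · rw [integral_neg] at h
    linarith
  · filter_upwards [measure_eq_zero_iff_ae_notMem.mp (hP.scalarMeasure_Iio_eq_zero hM x)]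
      with t ht _ using neg_le_neg (not_lt.mp ht)
  · filter_upwards [measure_eq_zero_iff_ae_notMem.mp hx] with t ht hta
    exact neg_le_neg (not_lt.mp fun hts => ht ⟨not_lt.mp hta, hts.le.trans hs⟩)

end Bounds

end ProjValuedMeasure.Represents

section BoundedOperator

variable {E : Type*} [NormedAddCommGroup E] [InnerProductSpace ℂ E] [CompleteSpace E]
  {H : E →ₗ.[ℂ] E} {T : E →L[ℂ] E}

theorem exists_represents_spectralPVM (hH : IsSelfAdjoint H) {Emin Emax : ℝ}
    (hE : ∀ x : H.domain, Emin * ‖(x : E)‖ ^ 2 ≤ (⟪(x : E), H x⟫_ℂ).re ∧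
      (⟪(x : E), H x⟫_ℂ).re ≤ Emax * ‖(x : E)‖ ^ 2) :
    ∃ T : E →L[ℂ] E, (spectralPVM H).Represents T ∧ H.domain = ⊤ ∧
      ∀ (x : E) (hx : x ∈ H.domain), H ⟨x, hx⟩ = T x := by
  obtain ⟨T, hT, htop, hHT⟩ := exists_continuousLinearMap_of_numericalRange_subset hH hE
  have hmem : ∀ x, x ∈ H.domain := fun x => htop ▸ Submodule.mem_top
  have h_exists : ∃ P, IsSpectralIntegral H P := by
    obtain ⟨P, hP, hP_sq⟩ := exists_projValuedMeasure_represents hT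
    exact ⟨P, fun x => ⟨fun _ => hP_sq x, fun _ => hmem x⟩,
      fun x => by rw [hHT x x.2, hP.inner_apply]⟩
  have h_spec : IsSpectralIntegral H (spectralPVM H) := Classical.epsilon_spec h_exists
  refine ⟨T, ⟨fun x => ?_, fun x => ?_⟩, htop, hHT⟩
  · have h_sq : MemLp (fun t : ℝ => t) 2 ((spectralPVM H).scalarMeasure x) :=
      (memLp_two_iff_integrable_sq measurable_id.aestronglyMeasurable).mpr
        ((h_spec.1 x).mp (hmem x))
    exact h_sq.integrable one_le_two
  · rw [← hHT x (hmem x)]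
    exact h_spec.2 ⟨x, hmem x⟩

theorem sesqForm_eq_inner (hP : (spectralPVM H).Represents T) (x y : E) :
    sesqForm H x y = ⟪x, T y⟫_ℂ := by
  have h_quad : ∀ z, ((quadForm H z : ℝ) : ℂ) = ⟪z, T z⟫_ℂ := fun z => (hP.inner_apply z).symm
  simp only [sesqForm, h_quad, map_add, map_sub, map_smul, inner_add_left, inner_add_right,
    inner_sub_left, inner_sub_right, inner_smul_left, inner_smul_right, Complex.conj_I]
  linear_combination (-(1 / 2) * ⟪x, T y⟫_ℂ + (1 / 2) * ⟪y, T x⟫_ℂ) * Complex.I_sq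

theorem eigenvalue_mem_Icc_of_mem_bandSubspace (hP : (spectralPVM H).Represents T)
    (hHT : ∀ (x : E) (hx : x ∈ H.domain), H ⟨x, hx⟩ = T x) {a b l : ℝ} {e : E}
    (he : T e = (l : ℂ) • e) (he0 : e ≠ 0) (hmem : e ∈ bandSubspace H a b) : l ∈ Set.Icc a b := by
  by_contra hl
  have h_le : bandSubspace H a b ≤ (ℂ ∙ e)ᗮ := by
    refine Submodule.span_le.mpr fun y ⟨hy, t, ht, hyt⟩ => ?_
    rw [hHT] at hyt
    have h_symm := hP.inner_apply_left e y
    rw [he, hyt, inner_smul_left, inner_smul_right, Complex.conj_ofReal] at h_symm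
    refine Submodule.mem_orthogonal_singleton_iff_inner_right.mpr ?_
    by_contra h_ne
    have h_eq : l = t := by exact_mod_cast mul_right_cancel₀ h_ne h_symm
    exact hl (h_eq ▸ ht)
  exact he0 <| inner_self_eq_zero.mp <|
    Submodule.mem_orthogonal_singleton_iff_inner_right.mp (h_le hmem)

theorem scalarMeasure_Icc_eq_zero_of_mem_orthogonal (hP : (spectralPVM H).Represents T)
    (htop : H.domain = ⊤) (hHT : ∀ (x : E) (hx : x ∈ H.domain), H ⟨x, hx⟩ = T x) {a b : ℝ}
    (hcont : NoContinuousSpectrumOn H a b) {n : E} (hn : n ∈ (bandSubspace H a b)ᗮ) :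
    (spectralPVM H).scalarMeasure n (Set.Icc a b) = 0 := by
  have h_atoms : ∀ t ∈ Set.Icc a b, (spectralPVM H).scalarMeasure n {t} = 0 := fun t ht => by
    have h_band : (spectralPVM H).proj {t} n ∈ bandSubspace H a b :=
      Submodule.subset_span ⟨htop ▸ Submodule.mem_top, t, ht, by
        rw [hHT, hP.apply_proj_singleton]⟩
    have h_orth := (Submodule.mem_orthogonal' _ _).mp hn _ h_band
    rw [ProjValuedMeasure.scalarMeasure, Measure.ofMeasurable_apply _ (measurableSet_singleton t),
      h_orth, Complex.zero_re, ENNReal.ofReal_zero]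
  have h := hcont ((spectralPVM H).proj (Set.Icc a b) n) fun t => ?_
  · rwa [ProjValuedMeasure.scalarMeasure_proj _ measurableSet_Icc, Measure.restrict_apply_self] at h
  · rw [ProjValuedMeasure.scalarMeasure_proj _ measurableSet_Icc,
      Measure.restrict_apply (measurableSet_singleton t)]
    by_cases ht : t ∈ Set.Icc a b
    · exact measure_mono_null Set.inter_subset_left (h_atoms t ht)
    · rw [Set.singleton_inter_eq_empty.mpr ht, measure_empty]

end BoundedOperator

section GeneralizedEigenvectors

open Matrix

open scoped MatrixOrder in
theorem posSemidef_mul_of_commute {ι : Type*} [Fintype ι] {M N : Matrix ι ι ℂ}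
    (hM : M.PosSemidef) (hN : N.PosSemidef) (h : Commute M N) : (M * N).PosSemidef := by
  classical
  exact Matrix.nonneg_iff_posSemidef.mp (h.mul_nonneg hM.nonneg hN.nonneg)

variable {n ι : Type*} [Fintype n] {A B : Matrix n n ℂ}

theorem posSemidef_conjTranspose_mul_sub_smul_mul [Fintype ι] [DecidableEq ι] (hA : A.IsHermitian)
    (hB : B.PosSemidef) {C : Matrix n ι ℂ} {l : ι → ℝ}
    (hC : A * C = B * C * diagonal fun i => (l i : ℂ)) {s : ℝ} (hs : ∀ i, s ≤ l i) :
    (Cᴴ * (A - (s : ℂ) • B) * C).PosSemidef := by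
  set D : Matrix ι ι ℂ := diagonal fun i => (l i : ℂ)
  have hD : D.IsHermitian := isHermitian_diagonal_of_self_adjoint _ <|
    funext fun i => Complex.conj_ofReal (l i)
  have hG : (Cᴴ * B * C).PosSemidef := hB.conjTranspose_mul_mul_same C
  have hGD : Cᴴ * A * C = Cᴴ * B * C * D := by simp only [Matrix.mul_assoc, hC]
  -- The columns of `C` need not be `B`-orthogonal: commutation comes from `Cᴴ A C` being Hermitian.
  have h_comm : Commute (Cᴴ * B * C) D := by
    have h := (isHermitian_conjTranspose_mul_mul C hA).eq
    rw [hGD, conjTranspose_mul, hG.isHermitian.eq, hD.eq] at h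
    exact h.symm
  have hDs : (D - (s : ℂ) • (1 : Matrix ι ι ℂ)).PosSemidef := by
    rw [smul_one_eq_diagonal, diagonal_sub, posSemidef_diagonal_iff]
    intro i
    rw [← Complex.ofReal_sub, Complex.zero_le_real]
    exact sub_nonneg.mpr (hs i)
  have h_eq : Cᴴ * (A - (s : ℂ) • B) * C = Cᴴ * B * C * (D - (s : ℂ) • (1 : Matrix ι ι ℂ)) := by
    rw [Matrix.mul_sub, Matrix.sub_mul, hGD, Matrix.mul_sub, Matrix.mul_smul, Matrix.smul_mul,
      Matrix.mul_smul, Matrix.mul_one]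
  rw [h_eq]
  exact posSemidef_mul_of_commute hG hDs
    (h_comm.sub_right ((Commute.one_right _).smul_right _))

theorem re_dotProduct_mulVec_sub_smul_nonneg [Finite ι] (hA : A.IsHermitian) (hB : B.PosSemidef)
    {c : ι → n → ℂ} {l : ι → ℝ} (hc : ∀ i, A *ᵥ c i = (l i : ℂ) • B *ᵥ c i) {s : ℝ}
    (hs : ∀ i, s ≤ l i) {x : n → ℂ} (hx : x ∈ Submodule.span ℂ (Set.range c)) :
    0 ≤ (star x ⬝ᵥ (A - (s : ℂ) • B) *ᵥ x).re := by
  classical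
  have := Fintype.ofFinite ι
  obtain ⟨z, rfl⟩ := (Submodule.mem_span_range_iff_exists_fun ℂ).mp hx
  set C : Matrix n ι ℂ := (Matrix.of c)ᵀ
  have hCz : ∑ i, z i • c i = C *ᵥ z := by
    ext j
    simp [C, mulVec, dotProduct, mul_comm]
  have hC : A * C = B * C * diagonal fun i => (l i : ℂ) := by
    ext j i
    have h := congrFun (hc i) j
    rw [mul_diagonal, mul_comm]
    exact h
  have h := (posSemidef_conjTranspose_mul_sub_smul_mul hA hB hC hs).dotProduct_mulVec_nonneg z
  rw [hCz, star_mulVec, ← dotProduct_mulVec, mulVec_mulVec, mulVec_mulVec]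
  exact (Complex.le_def.mp h).1

end GeneralizedEigenvectors

theorem exists_mem_span_ne_zero_apply_eq_zero {𝕜 V W ι : Type*} [DivisionRing 𝕜]
    [AddCommGroup V] [Module 𝕜 V] [AddCommGroup W] [Module 𝕜 W] [FiniteDimensional 𝕜 W]
    [Fintype ι] {c : ι → V} (hc : LinearIndependent 𝕜 c) (f : V →ₗ[𝕜] W)
    (h : Module.finrank 𝕜 W < Fintype.card ι) :
    ∃ x ∈ Submodule.span 𝕜 (Set.range c), x ≠ 0 ∧ f x = 0 := by
  have := FiniteDimensional.span_of_finite 𝕜 (Set.finite_range c)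
  obtain ⟨x, hx, hx0⟩ := (Submodule.ne_bot_iff _).mp
    (LinearMap.ker_ne_bot_of_finrank_lt
      (f := f ∘ₗ (Submodule.span 𝕜 (Set.range c)).subtype) (by rwa [finrank_span_eq_card hc]))
  exact ⟨x, x.2, by simpa using hx0, hx⟩

section CourantFischer

open Matrix

variable {n ι : Type*} [LinearOrder ι] {c : ι → n → ℂ}

theorem exists_mem_span_Iic_ne_zero [Finite ι] (hc : LinearIndependent ℂ c)
    (y : (n → ℂ) →ₗ[ℂ] (ι → ℂ)) (i : ι) :
    ∃ x ∈ Submodule.span ℂ (Set.range fun j : Set.Iic i => c j), x ≠ 0 ∧ ∀ k < i, y x k = 0 := by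
  have := Fintype.ofFinite ι
  have hcard : Fintype.card (Set.Iio i) < Fintype.card (Set.Iic i) :=
    Set.card_lt_card Set.Iio_ssubset_Iic_self
  obtain ⟨x, hx, hx0, hyx⟩ := exists_mem_span_ne_zero_apply_eq_zero
    (hc.comp _ Subtype.val_injective)
    (LinearMap.funLeft ℂ ℂ (Subtype.val : Set.Iio i → ι) ∘ₗ y)
    (by rwa [Module.finrank_fintype_fun_eq_card])
  exact ⟨x, hx, hx0, fun k hk => congrFun hyx ⟨k, hk⟩⟩

variable [Fintype n] [Fintype ι] {A B : Matrix n n ℂ} {l lT : ι → ℝ} {g R : ℝ}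

theorem sub_mul_le_of_re_dotProduct_mulVec_le (hA : A.IsHermitian) (hB : B.PosSemidef)
    (hc : LinearIndependent ℂ c) (hAB : ∀ i, A *ᵥ c i = (lT i : ℂ) • B *ᵥ c i)
    (hlT : Antitone lT) (hl : Antitone l) (y : (n → ℂ) →ₗ[ℂ] (ι → ℂ)) (hg : 0 ≤ g) (hR : 0 ≤ R)
    (h_gap : ∀ x, g * ∑ j, ‖x j‖ ^ 2 ≤ ∑ k, ‖y x k‖ ^ 2) (i : ι)
    (h_form : ∀ x, (star x ⬝ᵥ (A - (lT i : ℂ) • B) *ᵥ x).re ≤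
      ∑ k, (l k - lT i) * ‖y x k‖ ^ 2 + R * ∑ j, ‖x j‖ ^ 2) :
    (lT i - l i) * g ≤ R := by
  rcases le_total (lT i) (l i) with h_le | h_le
  · exact (mul_nonpos_of_nonpos_of_nonneg (sub_nonpos.mpr h_le) hg).trans hR
  obtain ⟨x, hx, hx0, hyx⟩ := exists_mem_span_Iic_ne_zero hc y i
  have h_norm : 0 < ∑ j, ‖x j‖ ^ 2 := by
    obtain ⟨j, hj⟩ := Function.ne_iff.mp hx0
    exact Finset.sum_pos' (fun _ _ => sq_nonneg _)
      ⟨j, Finset.mem_univ j, pow_pos (norm_pos_iff.mpr hj) 2⟩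
  have h_nonneg : 0 ≤ (star x ⬝ᵥ (A - (lT i : ℂ) • B) *ᵥ x).re :=
    re_dotProduct_mulVec_sub_smul_nonneg hA hB (fun j : Set.Iic i => hAB j)
      (fun j => hlT j.2) hx
  have h_band : ∑ k, (l k - lT i) * ‖y x k‖ ^ 2 ≤ (l i - lT i) * ∑ k, ‖y x k‖ ^ 2 := by
    rw [Finset.mul_sum]
    refine Finset.sum_le_sum fun k _ => ?_
    rcases lt_or_ge k i with hk | hk
    · simp [hyx k hk]
    · exact mul_le_mul_of_nonneg_right (sub_le_sub_right (hl hk) _) (sq_nonneg _)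
  refine le_of_mul_le_mul_right ?_ h_norm
  linarith [h_form x, mul_le_mul_of_nonneg_left (h_gap x) (sub_nonneg.mpr h_le)]

theorem le_sub_mul_of_le_re_dotProduct_mulVec (hA : A.IsHermitian) (hB : B.PosSemidef)
    (hc : LinearIndependent ℂ c) (hAB : ∀ i, A *ᵥ c i = (lT i : ℂ) • B *ᵥ c i)
    (hlT : Antitone lT) (hl : Antitone l) (y : (n → ℂ) →ₗ[ℂ] (ι → ℂ)) (hg : 0 ≤ g) (hR : R ≤ 0)
    (h_gap : ∀ x, g * ∑ j, ‖x j‖ ^ 2 ≤ ∑ k, ‖y x k‖ ^ 2) (i : ι)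
    (h_form : ∀ x, ∑ k, (l k - lT i) * ‖y x k‖ ^ 2 + R * ∑ j, ‖x j‖ ^ 2 ≤
      (star x ⬝ᵥ (A - (lT i : ℂ) • B) *ᵥ x).re) :
    R ≤ (lT i - l i) * g := by
  have h := sub_mul_le_of_re_dotProduct_mulVec_le (ι := ιᵒᵈ) hA.neg hB
    (hc.comp _ OrderDual.ofDual.injective) (lT := fun j => -lT (OrderDual.ofDual j))
    (l := fun j => -l (OrderDual.ofDual j)) (fun j => ?_)
    (fun j k hjk => neg_le_neg (hlT hjk)) (fun j k hjk => neg_le_neg (hl hjk)) y hg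
    (neg_nonneg.mpr hR) h_gap (OrderDual.toDual i) fun x => ?_
  · rw [OrderDual.ofDual_toDual] at h
    linarith
  · rw [neg_mulVec, Function.comp_apply, hAB, Complex.ofReal_neg, neg_smul]
  · have h_neg : -A - ((-lT i : ℝ) : ℂ) • B = -(A - (lT i : ℂ) • B) := by
      rw [Complex.ofReal_neg, neg_smul, neg_sub_neg, neg_sub]
    have h_sum : ∑ k, (-l k - -lT i) * ‖y x k‖ ^ 2 = -∑ k, (l k - lT i) * ‖y x k‖ ^ 2 := by
      rw [← Finset.sum_neg_distrib]
      exact Finset.sum_congr rfl fun k _ => by ring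
    have h_dual : (star x ⬝ᵥ (-A - ((-lT i : ℝ) : ℂ) • B) *ᵥ x).re ≤
        ∑ k, (-l k - -lT i) * ‖y x k‖ ^ 2 + -R * ∑ j, ‖x j‖ ^ 2 := by
      rw [h_neg, neg_mulVec, dotProduct_neg, Complex.neg_re, h_sum]
      linarith [h_form x]
    exact h_dual

end CourantFischer

section RayleighBounds

open Matrix

theorem re_star_dotProduct_self {n : Type*} [Fintype n] (x : n → ℂ) :
    (star x ⬝ᵥ x).re = ∑ i, ‖x i‖ ^ 2 := by
  rw [dotProduct_comm, ← WithLp.ofLp_toLp 2 x, ← EuclideanSpace.inner_eq_star_dotProduct,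
    ← EuclideanSpace.norm_sq_eq]
  exact inner_self_eq_norm_sq (𝕜 := ℂ) (WithLp.toLp 2 x)

open scoped MatrixOrder in
theorem re_dotProduct_mulVec_le_of_spectrum_le {n : Type*} [Fintype n] [DecidableEq n]
    {M : Matrix n n ℂ} (hM : M.IsHermitian) {r : ℝ} (hr : ∀ t ∈ spectrum ℝ M, t ≤ r)
    (x : n → ℂ) : (star x ⬝ᵥ M *ᵥ x).re ≤ r * ∑ i, ‖x i‖ ^ 2 := by
  have h_pos : (algebraMap ℝ (Matrix n n ℂ) r - M).PosSemidef := by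
    rwa [← Matrix.le_iff, le_algebraMap_iff_spectrum_le hM.isSelfAdjoint]
  have h := (Complex.le_def.mp (h_pos.dotProduct_mulVec_nonneg x)).1
  rw [sub_mulVec, dotProduct_sub, Algebra.algebraMap_eq_smul_one, smul_mulVec, one_mulVec,
    dotProduct_smul, Complex.sub_re, Complex.real_smul, Complex.re_ofReal_mul,
    re_star_dotProduct_self, Complex.zero_re] at h
  exact sub_nonneg.mp h

variable {m : ℕ} {M : Matrix (Fin m) (Fin m) ℂ}

theorem re_dotProduct_mulVec_le_eigMax (hM : M.IsHermitian) (x : Fin m → ℂ) :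
    (star x ⬝ᵥ M *ᵥ x).re ≤ eigMax M * ∑ i, ‖x i‖ ^ 2 :=
  re_dotProduct_mulVec_le_of_spectrum_le hM
    (fun _ ht => le_csSup M.finite_real_spectrum.bddAbove ht) x

theorem eigMin_le_re_dotProduct_mulVec (hM : M.IsHermitian) (x : Fin m → ℂ) :
    eigMin M * ∑ i, ‖x i‖ ^ 2 ≤ (star x ⬝ᵥ M *ᵥ x).re := by
  have h := re_dotProduct_mulVec_le_of_spectrum_le hM.neg (r := -eigMin M) (fun t ht => ?_) x
  · rw [neg_mulVec, dotProduct_neg, Complex.neg_re, neg_mul] at h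
    exact neg_le_neg_iff.mp h
  · rw [← spectrum.neg_eq, Set.mem_neg] at ht
    exact le_neg_of_le_neg (csInf_le M.finite_real_spectrum.bddBelow ht)

theorem re_dotProduct_mulVec_le_eigMaxStar (hM : M.IsHermitian) (x : Fin m → ℂ) :
    (star x ⬝ᵥ M *ᵥ x).re ≤ eigMaxStar M * ∑ i, ‖x i‖ ^ 2 :=
  (re_dotProduct_mulVec_le_eigMax hM x).trans <|
    mul_le_mul_of_nonneg_right (le_max_left _ _) (Finset.sum_nonneg fun _ _ => sq_nonneg _)

theorem eigMinStar_le_re_dotProduct_mulVec (hM : M.IsHermitian) (x : Fin m → ℂ) :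
    eigMinStar M * ∑ i, ‖x i‖ ^ 2 ≤ (star x ⬝ᵥ M *ᵥ x).re :=
  (mul_le_mul_of_nonneg_right (min_le_left _ _)
    (Finset.sum_nonneg fun _ _ => sq_nonneg _)).trans (eigMin_le_re_dotProduct_mulVec hM x)

theorem re_dotProduct_mulVec_le_matrixOpNorm (M : Matrix (Fin m) (Fin m) ℂ) (x : Fin m → ℂ) :
    (star x ⬝ᵥ M *ᵥ x).re ≤ matrixOpNorm M * ∑ i, ‖x i‖ ^ 2 := by
  set X : EuclideanSpace ℂ (Fin m) := WithLp.toLp 2 x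
  set L := Matrix.toEuclideanCLM (n := Fin m) (𝕜 := ℂ) M
  have h_inner : star x ⬝ᵥ M *ᵥ x = ⟪X, L X⟫_ℂ := by
    rw [EuclideanSpace.inner_eq_star_dotProduct, dotProduct_comm, ofLp_toEuclideanCLM]
  calc (star x ⬝ᵥ M *ᵥ x).re ≤ ‖⟪X, L X⟫_ℂ‖ := h_inner ▸ Complex.re_le_norm _
    _ ≤ ‖X‖ * ‖L X‖ := norm_inner_le_norm _ _
    _ ≤ ‖X‖ * (‖L‖ * ‖X‖) := mul_le_mul_of_nonneg_left (L.le_opNorm X) (norm_nonneg _)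
    _ = matrixOpNorm M * ∑ i, ‖x i‖ ^ 2 := by
      rw [← EuclideanSpace.norm_sq_eq X, matrixOpNorm]
      ring

end RayleighBounds

section BandDecomposition

variable {E ι : Type*} [NormedAddCommGroup E] [InnerProductSpace ℂ E] [Fintype ι]

open Matrix in
theorem star_dotProduct_inner_mulVec (L : E →ₗ[ℂ] E) (v : ι → E) (x : ι → ℂ) :
    star x ⬝ᵥ (Matrix.of fun i j => ⟪v i, L (v j)⟫_ℂ) *ᵥ x =
      ⟪Fintype.linearCombination ℂ v x, L (Fintype.linearCombination ℂ v x)⟫_ℂ := by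
  simp only [Fintype.linearCombination_apply, map_sum, map_smul, sum_inner, inner_sum,
    inner_smul_left, inner_smul_right, dotProduct, mulVec, Matrix.of_apply, Finset.mul_sum,
    Pi.star_apply, RCLike.star_def]
  rw [Finset.sum_comm]
  exact Finset.sum_congr rfl fun i _ => Finset.sum_congr rfl fun j _ => by ring

variable {K : Submodule ℂ E} [K.HasOrthogonalProjection] {e : ι → E}

theorem starProjection_eq_sum_inner_smul (he : Orthonormal ℂ e)
    (hK : Submodule.span ℂ (Set.range e) = K) (u : E) :
    K.starProjection u = ∑ k, ⟪e k, u⟫_ℂ • e k := by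
  have h_le : K ≤ (ℂ ∙ (u - ∑ k, ⟪e k, u⟫_ℂ • e k))ᗮ := by
    rw [← hK, Submodule.span_le]
    rintro _ ⟨k, rfl⟩
    refine Submodule.mem_orthogonal_singleton_iff_inner_left.mpr ?_
    rw [inner_sub_right, he.inner_right_fintype, sub_self]
  refine Submodule.eq_starProjection_of_mem_of_inner_eq_zero
    (Submodule.sum_mem _ fun k _ => K.smul_mem _ (hK ▸ Submodule.subset_span ⟨k, rfl⟩))
    fun w hw => ?_
  exact Submodule.mem_orthogonal_singleton_iff_inner_right.mp (h_le hw)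

theorem re_inner_apply_eq_sum_add {T : E →ₗ[ℂ] E} (hT : T.IsSymmetric) (he : Orthonormal ℂ e)
    (hK : Submodule.span ℂ (Set.range e) = K) {l : ι → ℝ} (hl : ∀ k, T (e k) = (l k : ℂ) • e k)
    (u : E) :
    (⟪u, T u⟫_ℂ).re = ∑ k, l k * ‖⟪e k, u⟫_ℂ‖ ^ 2 +
      (⟪Kᗮ.starProjection u, T (Kᗮ.starProjection u)⟫_ℂ).re := by
  set p := K.starProjection u
  set n := Kᗮ.starProjection u
  have hu : u = p + n := (K.starProjection_add_starProjection_orthogonal u).symm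
  have hp : p = ∑ k, ⟪e k, u⟫_ℂ • e k := starProjection_eq_sum_inner_smul he hK u
  have hTp : T p = ∑ k, ((l k : ℂ) * ⟪e k, u⟫_ℂ) • e k := by
    simp only [hp, map_sum, map_smul, hl, smul_smul, mul_comm]
  have hTpn : ⟪T p, n⟫_ℂ = 0 :=
    Submodule.inner_right_of_mem_orthogonal
      (hTp ▸ K.sum_mem fun k _ => K.smul_mem _ (hK ▸ Submodule.subset_span ⟨k, rfl⟩))
      (Submodule.starProjection_apply_mem _ u)
  have hpp : (⟪p, T p⟫_ℂ).re = ∑ k, l k * ‖⟪e k, u⟫_ℂ‖ ^ 2 := by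
    rw [hTp, hp, he.inner_sum, Complex.re_sum]
    refine Finset.sum_congr rfl fun k _ => ?_
    rw [mul_left_comm, Complex.re_ofReal_mul, ← Complex.normSq_eq_conj_mul_self,
      Complex.ofReal_re, Complex.normSq_eq_norm_sq]
  have hcross : ⟪p, T n⟫_ℂ = 0 ∧ ⟪n, T p⟫_ℂ = 0 :=
    ⟨hT p n ▸ hTpn, by rw [← inner_conj_symm, hTpn, map_zero]⟩
  calc (⟪u, T u⟫_ℂ).re = (⟪p + n, T (p + n)⟫_ℂ).re := by rw [← hu]
    _ = (⟪p, T p⟫_ℂ).re + (⟪n, T n⟫_ℂ).re := by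
      rw [map_add, inner_add_left, inner_add_right, inner_add_right, hcross.1, hcross.2,
        add_zero, zero_add, Complex.add_re]
    _ = _ := by rw [hpp]

theorem norm_sq_eq_sum_add (he : Orthonormal ℂ e) (hK : Submodule.span ℂ (Set.range e) = K)
    (u : E) : ‖u‖ ^ 2 = ∑ k, ‖⟪e k, u⟫_ℂ‖ ^ 2 + ‖Kᗮ.starProjection u‖ ^ 2 := by
  have h_norm : ∀ w : E, (⟪w, w⟫_ℂ).re = ‖w‖ ^ 2 := inner_self_eq_norm_sq (𝕜 := ℂ)
  have h := re_inner_apply_eq_sum_add (T := LinearMap.id) LinearMap.IsSymmetric.id he hK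
    (l := fun _ => 1) (fun k => by simp) u
  simpa only [LinearMap.id_apply, h_norm, one_mul] using h

end BandDecomposition

section RayleighRitz

open Matrix

variable {E : Type*} [NormedAddCommGroup E] [InnerProductSpace ℂ E] {m : ℕ}

theorem re_dotProduct_gram_mulVec (v : Fin m → E) (x : Fin m → ℂ) :
    (star x ⬝ᵥ gram ℂ v *ᵥ x).re = ‖Fintype.linearCombination ℂ v x‖ ^ 2 := by
  rw [star_dotProduct_gram_mulVec]
  exact inner_self_eq_norm_sq (𝕜 := ℂ) (Fintype.linearCombination ℂ v x)

variable {K : Submodule ℂ E} [K.HasOrthogonalProjection]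

theorem linearCombination_noise (v : Fin m → E) (x : Fin m → ℂ) :
    Fintype.linearCombination ℂ (noise K v) x =
      Kᗮ.starProjection (Fintype.linearCombination ℂ v x) := by
  simp only [Fintype.linearCombination_apply, map_sum, map_smul, noise]

theorem eigMin_sub_eigMax_mul_le {e : Fin m → E} (he : Orthonormal ℂ e)
    (hK : Submodule.span ℂ (Set.range e) = K) (v : Fin m → E) {D : Matrix (Fin m) (Fin m) ℂ}
    (hD : D.IsHermitian) (x : Fin m → ℂ) :
    (eigMin (gram ℂ v + D) - eigMax (gram ℂ (noise K v) + D)) * ∑ j, ‖x j‖ ^ 2 ≤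
      ∑ k, ‖⟪e k, Fintype.linearCombination ℂ v x⟫_ℂ‖ ^ 2 := by
  have h_min := eigMin_le_re_dotProduct_mulVec ((isHermitian_gram ℂ v).add hD) x
  have h_max := re_dotProduct_mulVec_le_eigMax ((isHermitian_gram ℂ (noise K v)).add hD) x
  rw [add_mulVec, dotProduct_add, Complex.add_re, re_dotProduct_gram_mulVec] at h_min h_max
  rw [linearCombination_noise] at h_max
  linarith [norm_sq_eq_sum_add he hK (Fintype.linearCombination ℂ v x)]

variable [CompleteSpace E] {H : E →ₗ.[ℂ] E} {T : E →L[ℂ] E}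

theorem norm_sq_proj_noise_le (v : Fin m → E) {I : Set ℝ} (hI : MeasurableSet I)
    (x : Fin m → ℂ) :
    ‖(spectralPVM H).proj I (Kᗮ.starProjection (Fintype.linearCombination ℂ v x))‖ ^ 2 ≤
      matrixOpNorm (spectralMatrix H (noise K v) I) * ∑ j, ‖x j‖ ^ 2 := by
  have h := star_dotProduct_inner_mulVec ((spectralPVM H).proj I : E →ₗ[ℂ] E) (noise K v) x
  rw [linearCombination_noise, ContinuousLinearMap.coe_coe,
    inner_apply_self_of_isStarProjection ((spectralPVM H).isStarProjection I hI)] at h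
  rw [← Complex.ofReal_re (‖_‖ ^ 2), ← h]
  exact re_dotProduct_mulVec_le_matrixOpNorm _ x

theorem mul_matrixOpNorm_nonneg (v : Fin m → E) {I : Set ℝ} {t : ℝ}
    (ht : 0 ≤ t ∨ (spectralPVM H).proj I = 0) :
    0 ≤ t * matrixOpNorm (spectralMatrix H (noise K v) I) := by
  rcases ht with ht | h_zero
  · exact mul_nonneg ht (norm_nonneg _)
  · have h_mat : spectralMatrix H (noise K v) I = 0 := by
      ext i j
      simp [spectralMatrix, h_zero]
    rw [h_mat, matrixOpNorm, map_zero, norm_zero, mul_zero]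

theorem mul_norm_sq_proj_noise_le (v : Fin m → E) {I : Set ℝ} (hI : MeasurableSet I) {t : ℝ}
    (ht : 0 ≤ t ∨ (spectralPVM H).proj I = 0) (x : Fin m → ℂ) :
    t * ‖(spectralPVM H).proj I (Kᗮ.starProjection (Fintype.linearCombination ℂ v x))‖ ^ 2 ≤
      t * matrixOpNorm (spectralMatrix H (noise K v) I) * ∑ j, ‖x j‖ ^ 2 := by
  rcases le_total 0 t with h_nonneg | h_nonpos
  · rw [mul_assoc]
    exact mul_le_mul_of_nonneg_left (norm_sq_proj_noise_le v hI x) h_nonneg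
  · calc _ ≤ (0 : ℝ) := mul_nonpos_of_nonpos_of_nonneg h_nonpos (sq_nonneg _)
      _ ≤ _ := mul_nonneg (mul_matrixOpNorm_nonneg v ht)
        (Finset.sum_nonneg fun _ _ => sq_nonneg _)

theorem formMatrix_eq_of_inner (hP : (spectralPVM H).Represents T) (v : Fin m → E) :
    formMatrix H v = Matrix.of fun i j => ⟪v i, (T : E →ₗ[ℂ] E) (v j)⟫_ℂ :=
  Matrix.ext fun _ _ => sesqForm_eq_inner hP _ _

theorem isHermitian_formMatrix (hP : (spectralPVM H).Represents T) (v : Fin m → E) :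
    (formMatrix H v).IsHermitian := by
  refine Matrix.IsHermitian.ext fun i j => ?_
  rw [formMatrix_eq_of_inner hP, of_apply, of_apply, ContinuousLinearMap.coe_coe,
    RCLike.star_def, inner_conj_symm, hP.inner_apply_left]

theorem re_dotProduct_formMatrix_mulVec (hP : (spectralPVM H).Represents T) (v : Fin m → E)
    (x : Fin m → ℂ) : (star x ⬝ᵥ formMatrix H v *ᵥ x).re =
      (⟪Fintype.linearCombination ℂ v x, T (Fintype.linearCombination ℂ v x)⟫_ℂ).re := by
  rw [formMatrix_eq_of_inner hP, star_dotProduct_inner_mulVec, ContinuousLinearMap.coe_coe]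

variable {e v : Fin m → E} {l lT : Fin m → ℝ} {δA δB : Matrix (Fin m) (Fin m) ℂ}
  {a b M : ℝ}

theorem re_dotProduct_sub_smul_mulVec_eq (hP : (spectralPVM H).Represents T)
    (he : Orthonormal ℂ e) (hK : Submodule.span ℂ (Set.range e) = K)
    (hl : ∀ k, T (e k) = (l k : ℂ) • e k) (s : ℝ) (x : Fin m → ℂ) {u : E}
    (hu : Fintype.linearCombination ℂ v x = u) :
    (star x ⬝ᵥ (formMatrix H v + δA - (s : ℂ) • (gram ℂ v + δB)) *ᵥ x).re =
      ∑ k, (l k - s) * ‖⟪e k, u⟫_ℂ‖ ^ 2 +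
        ((⟪Kᗮ.starProjection u, T (Kᗮ.starProjection u)⟫_ℂ).re -
          s * ‖Kᗮ.starProjection u‖ ^ 2) +
        (star x ⬝ᵥ (δA - (s : ℂ) • δB) *ᵥ x).re := by
  have h_split : formMatrix H v + δA - (s : ℂ) • (gram ℂ v + δB) =
      formMatrix H v - (s : ℂ) • gram ℂ v + (δA - (s : ℂ) • δB) := by
    rw [smul_add]
    abel
  have h_form := re_inner_apply_eq_sum_add (T := (T : E →ₗ[ℂ] E)) hP.inner_apply_left he hK hl u
  have h_norm := norm_sq_eq_sum_add he hK u
  rw [ContinuousLinearMap.coe_coe] at h_form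
  rw [h_split, add_mulVec, sub_mulVec, smul_mulVec, dotProduct_add, dotProduct_sub,
    dotProduct_smul, Complex.add_re, Complex.sub_re, smul_eq_mul, Complex.re_ofReal_mul,
    re_dotProduct_gram_mulVec, re_dotProduct_formMatrix_mulVec hP, hu, h_form, h_norm]
  simp only [sub_mul, Finset.sum_sub_distrib, ← Finset.mul_sum]
  ring

theorem isHermitian_sub_ofReal_smul (hδA : δA.IsHermitian) (hδB : δB.IsHermitian) (s : ℝ) :
    (δA - (s : ℂ) • δB).IsHermitian :=
  hδA.sub (hδB.smul (Complex.conj_ofReal s))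

theorem genEigenvalue_sub_le (hP : (spectralPVM H).Represents T)
    (hM : ∀ x, (⟪x, T x⟫_ℂ).re ≤ M * ‖x‖ ^ 2) (he : Orthonormal ℂ e)
    (hK : Submodule.span ℂ (Set.range e) = K) (hl : ∀ k, T (e k) = (l k : ℂ) • e k)
    (hl_anti : Antitone l) (hl_ge : ∀ k, a ≤ l k)
    (hband : ∀ n ∈ Kᗮ, (spectralPVM H).scalarMeasure n (Set.Icc a b) = 0)
    (hδA : δA.IsHermitian) (hδB : δB.IsHermitian) (hB : (gram ℂ v + δB).PosSemidef)
    (hlT : IsGenEigenvalues (formMatrix H v + δA) (gram ℂ v + δB) lT)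
    (hwell : eigMax (gram ℂ (noise K v) + δB) < eigMin (gram ℂ v + δB)) {i : Fin m}
    (hi : lT i ≤ M ∨ M ≤ b) :
    lT i - l i ≤ ((M - lT i) * matrixOpNorm (spectralMatrix H (noise K v) (Set.Ioi b)) +
      eigMaxStar (δA - (lT i : ℂ) • δB)) /
        (eigMin (gram ℂ v + δB) - eigMax (gram ℂ (noise K v) + δB)) := by
  obtain ⟨hlT_anti, c, hc, hAB⟩ := hlT
  have hg := sub_pos.mpr hwell
  have ht : 0 ≤ M - lT i ∨ (spectralPVM H).proj (Set.Ioi b) = 0 :=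
    hi.imp sub_nonneg.mpr (hP.proj_Ioi_eq_zero hM)
  have hR := add_nonneg (mul_matrixOpNorm_nonneg (K := K) v ht)
    (le_max_right _ _ : 0 ≤ eigMaxStar (δA - (lT i : ℂ) • δB))
  rcases lt_or_ge (lT i) a with h_lt | h_ge
  · exact (sub_nonpos.mpr (h_lt.le.trans (hl_ge i))).trans (div_nonneg hR hg.le)
  rw [le_div_iff₀ hg]
  refine sub_mul_le_of_re_dotProduct_mulVec_le ((isHermitian_formMatrix hP v).add hδA) hB hc hAB
    hlT_anti hl_anti
    (LinearMap.pi fun k => (innerSL ℂ (e k) : E →ₗ[ℂ] ℂ) ∘ₗ Fintype.linearCombination ℂ v)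
    hg.le hR (eigMin_sub_eigMax_mul_le he hK v hδB) i fun x => ?_
  have h_noise := hP.re_inner_apply_sub_le hM h_ge (hband _
    (Kᗮ.starProjection_apply_mem (Fintype.linearCombination ℂ v x)))
  have h_norm := mul_norm_sq_proj_noise_le (K := K) v measurableSet_Ioi ht x
  have h_pert := re_dotProduct_mulVec_le_eigMaxStar
    (isHermitian_sub_ofReal_smul hδA hδB (lT i)) x
  rw [re_dotProduct_sub_smul_mulVec_eq hP he hK hl _ x rfl, add_assoc, add_mul]
  exact add_le_add le_rfl (add_le_add (h_noise.trans h_norm) h_pert)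

theorem le_genEigenvalue_sub (hP : (spectralPVM H).Represents T)
    (hM : ∀ x, M * ‖x‖ ^ 2 ≤ (⟪x, T x⟫_ℂ).re) (he : Orthonormal ℂ e)
    (hK : Submodule.span ℂ (Set.range e) = K) (hl : ∀ k, T (e k) = (l k : ℂ) • e k)
    (hl_anti : Antitone l) (hl_le : ∀ k, l k ≤ b)
    (hband : ∀ n ∈ Kᗮ, (spectralPVM H).scalarMeasure n (Set.Icc a b) = 0)
    (hδA : δA.IsHermitian) (hδB : δB.IsHermitian) (hB : (gram ℂ v + δB).PosSemidef)
    (hlT : IsGenEigenvalues (formMatrix H v + δA) (gram ℂ v + δB) lT)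
    (hwell : eigMax (gram ℂ (noise K v) + δB) < eigMin (gram ℂ v + δB)) {i : Fin m}
    (hi : M ≤ lT i ∨ a ≤ M) :
    ((M - lT i) * matrixOpNorm (spectralMatrix H (noise K v) (Set.Iio a)) +
      eigMinStar (δA - (lT i : ℂ) • δB)) /
        (eigMin (gram ℂ v + δB) - eigMax (gram ℂ (noise K v) + δB)) ≤ lT i - l i := by
  obtain ⟨hlT_anti, c, hc, hAB⟩ := hlT
  have hg := sub_pos.mpr hwell
  have ht : 0 ≤ lT i - M ∨ (spectralPVM H).proj (Set.Iio a) = 0 :=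
    hi.imp sub_nonneg.mpr (hP.proj_Iio_eq_zero hM)
  have hR : (M - lT i) * matrixOpNorm (spectralMatrix H (noise K v) (Set.Iio a)) +
      eigMinStar (δA - (lT i : ℂ) • δB) ≤ 0 := by
    have h_pert : eigMinStar (δA - (lT i : ℂ) • δB) ≤ 0 := min_le_right _ _
    linarith [mul_matrixOpNorm_nonneg (K := K) v ht]
  rcases lt_or_ge b (lT i) with h_lt | h_ge
  · exact (div_nonpos_of_nonpos_of_nonneg hR hg.le).trans
      (sub_nonneg.mpr ((hl_le i).trans h_lt.le))
  rw [div_le_iff₀ hg]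
  refine le_sub_mul_of_le_re_dotProduct_mulVec ((isHermitian_formMatrix hP v).add hδA) hB hc hAB
    hlT_anti hl_anti
    (LinearMap.pi fun k => (innerSL ℂ (e k) : E →ₗ[ℂ] ℂ) ∘ₗ Fintype.linearCombination ℂ v)
    hg.le hR (eigMin_sub_eigMax_mul_le he hK v hδB) i fun x => ?_
  have h_noise := hP.le_re_inner_apply_sub hM h_ge (hband _
    (Kᗮ.starProjection_apply_mem (Fintype.linearCombination ℂ v x)))
  have h_norm := mul_norm_sq_proj_noise_le (K := K) v measurableSet_Iio ht x
  have h_pert := eigMinStar_le_re_dotProduct_mulVec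
    (isHermitian_sub_ofReal_smul hδA hδB (lT i)) x
  rw [re_dotProduct_sub_smul_mulVec_eq hP he hK hl _ x rfl, add_assoc, add_mul]
  refine add_le_add le_rfl (add_le_add (le_trans ?_ h_noise) h_pert)
  linarith

end RayleighRitz

theorem mainTheorem6 {E : Type*} [NormedAddCommGroup E] [InnerProductSpace ℂ E] [CompleteSpace E]
    (H : E →ₗ.[ℂ] E) (hdense : Dense (H.domain : Set E)) (hH : IsSelfAdjoint H)
    (a b : ℝ) (m : ℕ)
    [FiniteDimensional ℂ (bandSubspace H a b)]
    (hm : Module.finrank ℂ (bandSubspace H a b) = m)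
    -- trial vectors and the perturbed problem `[A, B]`
    (v : Fin m → E) (hv : ∀ i, v i ∈ formDomain H)
    (A B δA δB NB : Matrix (Fin m) (Fin m) ℂ)
    (hδA : δA.IsHermitian) (hδB : δB.IsHermitian)
    (hA : A = formMatrix H v + δA) (hB : B = Matrix.gram ℂ v + δB)
    (hBpos : B.PosDef)
    -- the noise weight `N† N + δB`
    (hNB : NB = Matrix.gram ℂ (noise (bandSubspace H a b) v) + δB)
    -- the eigenvalues of `H` in the band and of `[A, B]`, in decreasing order
    (lam lamT : Fin m → ℝ)
    (hlam : IsEigenvaluesIn H (bandSubspace H a b) lam)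
    (hlamT : IsGenEigenvalues A B lamT)
    -- the numerical range of `H` is contained in `[Emin, Emax]`
    (Emin Emax : ℝ)
    (hE : ∀ x : H.domain, Emin * ‖(x : E)‖ ^ 2 ≤ (inner ℂ (x : E) (H x)).re ∧
      (inner ℂ (x : E) (H x)).re ≤ Emax * ‖(x : E)‖ ^ 2)
    -- the problem is well-conditioned
    (hwell : eigMax NB < eigMin B)
    (hcont : NoContinuousSpectrumOn H a b) :
    ∀ i : Fin m,
      (Emin ≤ lamT i ∨ a ≤ Emin →
        ((Emin - lamT i) *
            matrixOpNorm (spectralMatrix H (noise (bandSubspace H a b) v) (Set.Iio a))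
          + eigMinStar (δA - (lamT i : ℂ) • δB)) / (eigMin B - eigMax NB)
          ≤ lamT i - lam i) ∧
      (lamT i ≤ Emax ∨ Emax ≤ b →
        lamT i - lam i ≤
        ((Emax - lamT i) *
            matrixOpNorm (spectralMatrix H (noise (bandSubspace H a b) v) (Set.Ioi b))
          + eigMaxStar (δA - (lamT i : ℂ) • δB)) / (eigMin B - eigMax NB)) := by
  subst hA hB hNB
  obtain ⟨T, hP, htop, hHT⟩ := exists_represents_spectralPVM hH hE
  obtain ⟨hlam_anti, e, he, hK, he_eig⟩ := hlam
  have hmem : ∀ x, x ∈ H.domain := fun x => htop ▸ Submodule.mem_top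
  have hT_bounds : ∀ x, Emin * ‖x‖ ^ 2 ≤ (⟪x, T x⟫_ℂ).re ∧ (⟪x, T x⟫_ℂ).re ≤ Emax * ‖x‖ ^ 2 :=
    fun x => hHT x (hmem x) ▸ hE ⟨x, hmem x⟩
  have hTe : ∀ k, T (e k) = (lam k : ℂ) • e k := fun k =>
    (he_eig k).elim fun hk h => (hHT (e k) hk).symm.trans h
  have hlam_mem : ∀ k, lam k ∈ Set.Icc a b := fun k =>
    eigenvalue_mem_Icc_of_mem_bandSubspace hP hHT (hTe k) (he.ne_zero k)
      (hK ▸ Submodule.subset_span ⟨k, rfl⟩)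
  have hband : ∀ n ∈ (bandSubspace H a b)ᗮ, (spectralPVM H).scalarMeasure n (Set.Icc a b) = 0 :=
    fun _ => scalarMeasure_Icc_eq_zero_of_mem_orthogonal hP htop hHT hcont
  exact fun i =>
    ⟨le_genEigenvalue_sub hP (fun x => (hT_bounds x).1) he hK hTe hlam_anti
      (fun k => (hlam_mem k).2) hband hδA hδB hBpos.posSemidef hlamT hwell,
    genEigenvalue_sub_le hP (fun x => (hT_bounds x).2) he hK hTe hlam_anti
      (fun k => (hlam_mem k).1) hband hδA hδB hBpos.posSemidef hlamT hwell⟩
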